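/- **Setting.** Consider $C$ bosonic components in $\mathbb{R}^D$ and an integration region $\mathcal{A}\subseteq\mathbb{R}^D$; all coordinate integrals $\int d\boldsymbol{x}$ are over $\mathcal{A}$. For each component $j$ let $(\phi_{j,n})_{n\in\mathbb{M}_j}$ be a finite orthonormal family in $L^2(\mathcal{A})$ (the restricted modes; the families of different components are arbitrary relative to one another). On the bosonic Fock space $\mathcal{H}$ over all modes $(j,n)$, with annihilation operators $\hat a_{j,n}$, put $\tilde\Psi_j(\boldsymbol{x})=\sum_{n\in\mathbb{M}_j}\phi_{j,n}(\boldsymbol{x})\hat a_{j,n}$. For amplitudes $\alpha=(\alpha_{j,n})\in\mathbb{C}^{N}$, $N=\sum_j|\mathbb{M}_j|$, put $\Psi_j(\boldsymbol{x})=\sum_n\phi_{j,n}(\boldsymbol{x})\alpha_{j,n}$, and likewise $\Lambda_j=\sum_n\phi_{j,n}\lambda_{j,n}$. Functionals of $\boldsymbol\Psi$ are regarded as functions of $\alpha$, $\int\delta^2\boldsymbol\Lambda$ is the Lebesgue integral over $\lambda\in\mathbb{C}^N$, and functional derivatives are defined through Wirtinger derivatives: $$\frac{\delta F}{\delta\Psi_j(\boldsymbol{x})}=\sum_n\phi_{j,n}^*(\boldsymbol{x})\frac{\partial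 F}{\partial\alpha_{j,n}},\qquad \frac{\delta F}{\delta\Psi_j^*(\boldsymbol{x})}=\sum_n\phi_{j,n}(\boldsymbol{x})\frac{\partial F}{\partial\alpha_{j,n}^*}.$$ The functional Wigner transform of a Hilbert–Schmidt operator $\hat A$ on $\mathcal{H}$ is $$\mathcal{W}[\hat A]=\frac{1}{\pi^{2N}}\int\delta^2\boldsymbol\Lambda\,\Big(\prod_{j}e^{\int d\boldsymbol{x}(-\Lambda_j\Psi_j^*+\Lambda_j^*\Psi_j)}\Big)\,\mathrm{Tr}\Big\{\hat A\prod_j e^{\int d\boldsymbol{x}(\Lambda_j\tilde\Psi_j^\dagger-\Lambda_j^*\tilde\Psi_j)}\Big\},$$ where the trace, summed over the number states, and the integral, taken over bounded sets exhausting $\mathbb{C}^N$, are limits in $L^2$. **Theorem.** Let $j,k\in\{1,\dots,C\}$ and let $\hat A$ be a Hilbert–Schmidt operator on $\mathcal{H}$ whose commutator $\hat B=\big[\int d\boldsymbol{x}\,\tilde\Psi_j^\dagger\tilde\Psi_k,\hat A\big]$, taken on the vectors with finitely many nonzero number-state coefficients, extends to a Hilbert–Schmidt operator. Then $\mathcal{W}[\hat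 A]$ and $\mathcal{W}[\hat B]$ exist as square-integrable functionals, and $$\mathcal{W}\Big[\Big[\int d\boldsymbol{x}\,\tilde\Psi_j^\dagger\tilde\Psi_k,\hat A\Big]\Big]=\int d\boldsymbol{x}\Big(-\frac{\delta}{\delta\Psi_j}\Psi_k+\frac{\delta}{\delta\Psi_k^*}\Psi_j^*\Big)\mathcal{W}[\hat A]$$ (the derivatives act on everything to their right), with the functional derivatives taken in the weak sense, i.e. the identity is tested against smooth compactly supported functionals, the derivatives being moved to the test functional and, for each $\boldsymbol{x}$, paired with it before the integral over $\boldsymbol{x}$. If moreover $\mathcal{W}[\hat A]$ has a continuously (real-)differentiable representative, the identity holds almost everywhere with classical Wirtinger functional derivatives of this representative. -/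

import Mathlib

open MeasureTheory Filter Topology
open scoped ComplexConjugate ContDiff

noncomputable section

namespace FunctionalWigner

/-- The modes of all `C` components together: `⟨j, n⟩` is the mode `n ∈ M j` of component `j`. -/
abbrev Mode {C : ℕ} (M : Fin C → Type*) := Σ j : Fin C, M j

/-- Mode amplitudes of all components. Through the bijection `α ↦ (∑ n, φ j n * α ⟨j, n⟩)_j` these
are the points of the product of the restricted function spaces `𝔽_{M j}`; a functional of the
restricted fields is a function of `Amp M`, and the functional integral is the Lebesgue integral
over `Amp M` (the product of the area measures of the complex planes). -/
abbrev Amp {C : ℕ} (M : Fin C → Type*) := Mode M → ℂ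

/-- Occupation numbers of the modes. -/
abbrev Occ {C : ℕ} (M : Fin C → Type*) := Mode M → ℕ

/-- The bosonic Fock space over the restricted modes, in the occupation number representation. -/
abbrev Fock {C : ℕ} (M : Fin C → Type*) := lp (fun _ : Occ M => ℂ) 2

/-- The restricted mode functions: for each component `j` a finite family, orthonormal
in `L²(region)`. -/
structure RestrictedBasis (D : ℕ) {C : ℕ} (M : Fin C → Type*) [∀ j, DecidableEq (M j)] where
  /-- The area over which all coordinate integrals are taken. -/
  region : Set (EuclideanSpace ℝ (Fin D))
  /-- The mode functions. -/
  φ : ∀ j : Fin C, M j → EuclideanSpace ℝ (Fin D) → ℂ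
  memLp : ∀ j n, MemLp (φ j n) 2 (volume.restrict region)
  orthonormal : ∀ j m n,
    ∫ x in region, conj (φ j m x) * φ j n x = if m = n then (1 : ℂ) else 0

section Modes

variable {C : ℕ} {M : Fin C → Type*} [∀ j, Fintype (M j)] [∀ j, DecidableEq (M j)]

/-- The single-mode annihilation operator `a_i`, acting on arbitrary coefficient sequences in the
number basis: `a_i |n⟩ = √n_i |n - 1_i⟩`. -/
def annihilate (i : Mode M) (c : Occ M → ℂ) : Occ M → ℂ :=
  fun n => (Real.sqrt (n i + 1 : ℝ) : ℂ) * c (n + Pi.single i 1)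

/-- The single-mode creation operator `a_i†`: `a_i† |n⟩ = √(n_i + 1) |n + 1_i⟩`. -/
def create (i : Mode M) (c : Occ M → ℂ) : Occ M → ℂ :=
  fun n => (Real.sqrt (n i : ℝ) : ℂ) * c (n - Pi.single i 1)

/-- The number state `|n⟩`. -/
def numberState (n : Occ M) : Fock M := lp.single 2 n (1 : ℂ)

/-- Hilbert-Schmidt operators on the Fock space. -/
def IsHilbertSchmidt (A : Fock M →L[ℂ] Fock M) : Prop :=
  Summable fun n : Occ M => ‖A (numberState n)‖ ^ 2

/-- `U` is the exponential of the operator `X` (given on coefficient sequences): on every number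
state it is the sum of the exponential series of `X`. -/
def IsExponentialOf (X : (Occ M → ℂ) → (Occ M → ℂ)) (U : Fock M →L[ℂ] Fock M) : Prop :=
  ∀ n m : Occ M,
    HasSum (fun k : ℕ => ((k.factorial : ℂ))⁻¹ * (X^[k] (numberState n)) m) (U (numberState n) m)

/-- `B` is (the bounded extension of) the commutator `[T, A] = T A - A T` of the possibly unbounded
operator `T` with the bounded operator `A`: it agrees with `T A - A T` on all vectors `v` with
finitely many nonzero number state coefficients. -/
def IsCommutator (T : (Occ M → ℂ) → (Occ M → ℂ)) (A B : Fock M →L[ℂ] Fock M) : Prop :=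
  ∀ v u : Fock M, (Function.support (v : Occ M → ℂ)).Finite →
    (u : Occ M → ℂ) = T v → ((B v : Fock M) : Occ M → ℂ) = T (A v) - ((A u : Fock M) : Occ M → ℂ)

/-- Wirtinger derivative `∂F/∂α_i = (∂F/∂(Re α_i) - i ∂F/∂(Im α_i)) / 2`. -/
def wirtinger (i : Mode M) (F : Amp M → ℂ) (α : Amp M) : ℂ :=
  (lineDeriv ℝ F α (Pi.single i 1) - Complex.I * lineDeriv ℝ F α (Pi.single i Complex.I)) / 2

/-- Wirtinger derivative `∂F/∂α_i^* = (∂F/∂(Re α_i) + i ∂F/∂(Im α_i)) / 2`. -/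
def wirtingerConj (i : Mode M) (F : Amp M → ℂ) (α : Amp M) : ℂ :=
  (lineDeriv ℝ F α (Pi.single i 1) + Complex.I * lineDeriv ℝ F α (Pi.single i Complex.I)) / 2

/-- Test functionals: smooth with compact support. -/
def IsTestFunctional (η : Amp M → ℂ) : Prop := ContDiff ℝ ∞ η ∧ HasCompactSupport η

end Modes

namespace RestrictedBasis

variable {D C : ℕ} {M : Fin C → Type*} [∀ j, Fintype (M j)] [∀ j, DecidableEq (M j)]

/-- The restricted field `Ψ_j(x) = ∑ n, φ_{j,n}(x) α_{j,n}` with amplitudes `α`. -/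
def field (b : RestrictedBasis D M) (j : Fin C) (α : Amp M) (x : EuclideanSpace ℝ (Fin D)) : ℂ :=
  ∑ n : M j, b.φ j n x * α ⟨j, n⟩

/-- The restricted field operator `Ψ̃_j(x) = ∑ n, φ_{j,n}(x) a_{j,n}`. -/
def fieldOp (b : RestrictedBasis D M) (j : Fin C) (x : EuclideanSpace ℝ (Fin D))
    (c : Occ M → ℂ) : Occ M → ℂ :=
  fun m => ∑ n : M j, b.φ j n x * annihilate ⟨j, n⟩ c m

/-- The adjoint field operator `Ψ̃_j†(x) = ∑ n, φ_{j,n}(x)^* a_{j,n}†`. -/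
def fieldOpAdj (b : RestrictedBasis D M) (j : Fin C) (x : EuclideanSpace ℝ (Fin D))
    (c : Occ M → ℂ) : Occ M → ℂ :=
  fun m => ∑ n : M j, conj (b.φ j n x) * create ⟨j, n⟩ c m

/-- The operator `∫ dx Ψ̃_j† Ψ̃_k`. -/
def bilinearOp (b : RestrictedBasis D M) (j k : Fin C) (c : Occ M → ℂ) : Occ M → ℂ :=
  fun m => ∫ x in b.region, b.fieldOpAdj j x (b.fieldOp k x c) m

/-- The exponent `∫ dx (Λ_j Ψ̃_j† - Λ_j^* Ψ̃_j)` of the displacement operator. -/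
def displacementExponent (b : RestrictedBasis D M) (j : Fin C) (l : Amp M) (c : Occ M → ℂ) :
    Occ M → ℂ :=
  fun m => ∫ x in b.region,
    (b.field j l x * b.fieldOpAdj j x c m - conj (b.field j l x) * b.fieldOp j x c m)

/-- `U j l` is the functional displacement operator
`D̂_j[Λ_j, Λ_j^*] = exp ∫ dx (Λ_j Ψ̃_j† - Λ_j^* Ψ̃_j)` for all components `j` and all fields `Λ`. -/
def IsDisplacement (b : RestrictedBasis D M) (U : Fin C → Amp M → (Fock M →L[ℂ] Fock M)) : Prop :=
  ∀ j l, IsExponentialOf (b.displacementExponent j l) (U j l)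

/-- The displacement functional `D[Λ_j, Λ_j^*, Ψ_j, Ψ_j^*] = exp ∫ dx (-Λ_j Ψ_j^* + Λ_j^* Ψ_j)`. -/
def displacementFunctional (b : RestrictedBasis D M) (j : Fin C) (l α : Amp M) : ℂ :=
  Complex.exp (∫ x in b.region,
    (-(b.field j l x * conj (b.field j α x)) + conj (b.field j l x) * b.field j α x))

/-- `χ` is the characteristic functional `Λ ↦ Tr {A ∏_j D̂_j[Λ_j, Λ_j^*]}` of `A`. For a general
Hilbert-Schmidt `A` the trace is a square-integrable functional of `Λ`: the sum
`∑_n ⟨n| A ∏_j D̂_j[Λ_j, Λ_j^*] |n⟩` over the number states is taken in `L²`. -/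
def IsCharacteristic (b : RestrictedBasis D M) (A : Fock M →L[ℂ] Fock M) (χ : Amp M → ℂ) : Prop :=
  ∃ U : Fin C → Amp M → (Fock M →L[ℂ] Fock M), b.IsDisplacement U ∧ MemLp χ 2 volume ∧
    Tendsto (fun s : Finset (Occ M) => eLpNorm (fun l : Amp M => χ l -
      ∑ n ∈ s, inner ℂ (numberState n)
        ((A * (List.ofFn fun j => U j l).prod) (numberState n))) 2 volume) atTop (𝓝 0)

/-- `w` is (a representative of) the functional Wigner transform of `A`,
`π^{-2 ∑ |M_j|} ∫ δ²Λ (∏_j D[Λ_j, Λ_j^*, Ψ_j, Ψ_j^*]) Tr {A ∏_j D̂_j[Λ_j, Λ_j^*]}`.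
As usual for the Fourier transform of a square-integrable functional, the integral is the limit in
`L²` of the integrals over bounded sets exhausting the whole space. -/
def IsWignerTransform (b : RestrictedBasis D M) (A : Fock M →L[ℂ] Fock M) (w : Amp M → ℂ) : Prop :=
  MemLp w 2 volume ∧ ∃ χ : Amp M → ℂ, b.IsCharacteristic A χ ∧
    Tendsto (fun R : ℝ => eLpNorm (fun α : Amp M => w α -
      ((Real.pi : ℂ) ^ (2 * ∑ j, Fintype.card (M j)))⁻¹ *
        ∫ l in Metric.closedBall (0 : Amp M) R,
          (∏ j, b.displacementFunctional j l α) * χ l) 2 volume) atTop (𝓝 0)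

open Classical in
/-- The functional Wigner transform `𝒲[A]` (a square-integrable functional, determined almost
everywhere). -/
def wigner (b : RestrictedBasis D M) (A : Fock M →L[ℂ] Fock M) : Amp M → ℂ :=
  if h : ∃ w, b.IsWignerTransform A w then h.choose else 0

/-- The functional derivative `δF/δΨ_j(x) = ∑ n, φ_{j,n}(x)^* ∂F/∂α_{j,n}`. -/
def funcDeriv (b : RestrictedBasis D M) (j : Fin C) (x : EuclideanSpace ℝ (Fin D))
    (F : Amp M → ℂ) (α : Amp M) : ℂ :=
  ∑ n : M j, conj (b.φ j n x) * wirtinger ⟨j, n⟩ F α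

/-- The functional derivative `δF/δΨ_j^*(x) = ∑ n, φ_{j,n}(x) ∂F/∂α_{j,n}^*`. -/
def funcDerivConj (b : RestrictedBasis D M) (j : Fin C) (x : EuclideanSpace ℝ (Fin D))
    (F : Amp M → ℂ) (α : Amp M) : ℂ :=
  ∑ n : M j, b.φ j n x * wirtingerConj ⟨j, n⟩ F α

/-- The weak functional derivative `δF/δΨ_j(x)` paired with the test functional `η`. -/
def weakFuncDeriv (b : RestrictedBasis D M) (j : Fin C) (x : EuclideanSpace ℝ (Fin D))
    (F η : Amp M → ℂ) : ℂ :=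
  -∫ α : Amp M, F α * b.funcDeriv j x η α

/-- The weak functional derivative `δF/δΨ_j^*(x)` paired with the test functional `η`. -/
def weakFuncDerivConj (b : RestrictedBasis D M) (j : Fin C) (x : EuclideanSpace ℝ (Fin D))
    (F η : Amp M → ℂ) : ℂ :=
  -∫ α : Amp M, F α * b.funcDerivConj j x η α

end RestrictedBasis

end FunctionalWigner

end

/-!
The displacement operators are represented by their matrix elements `dispFun m n λ = ⟨m| D(λ) |n⟩`,
products over the modes of the single-mode elements `dispElem`: a Gaussian times a complex Hermite
polynomial `hermitePoly` in `λ` and `λ^*`. The identity `prod_ofFn_dispOp` shows that the product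
over the components of the functional displacement operators is the operator `dispOp` with these
matrix elements; orthonormality of the modes within one component is all that is used.

**Existence.** The ladder relations express `λ_p D(λ)` and `∂D(λ)/∂λ_p` through `a_p`, `a_p†`. With
integration by parts they give recursions for the Gram matrix `dispGram` of the functions
`dispFun m n` in `L²`, whose only solutions are the multiples of the identity (`dispGram_eq`). So
`A ↦ Tr (A D(λ))` is, up to a constant factor, an isometry from the Hilbert-Schmidt operators,
regarded as square-summable matrices, into `L²` (`charMap`). By Plancherel's theorem the symplectic
Fourier transform `symplFourierLp` is bounded on `L²`, and the limit over exhausting balls is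
continuity of the Fourier transform under truncation. Hence `𝒲` is a continuous linear map
`wignerMap` from matrices to `L²` (`isWignerTransform_wigner`, `IsWignerTransform.ae_eq`).

**Weak identity.** For a single pair of modes, `[D(λ), a_p† a_q]` is a first order differential
operator in `λ` applied to `D(λ)` (`commutator_dispFun`). The Fourier transform and an integration by
parts turn it into the operator `transferOp p q = α_q ∂_p - α_p^* ∂_q^*` acting on the test
functional (`dispPairing_transferOp`). Pairing with a test functional is an absolutely convergent
trace (`hasSum_wignerMap_pairing`), and `a_p† a_q` preserves the particle number, so the commutator
is moved from `A` to `D(λ)` in the trace truncated to at most `K` particles, without boundary terms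
(`sum_commutator_mul`); then `K → ∞`. The integral over `x` enters only through the overlaps
`∫ dx φ_{j,p}^* φ_{k,q}`, on the operator side and on the functional side alike.

**Classical identity.** For a continuously differentiable representative the derivatives are moved
back from the test functional by parts (`IsTestFunctional.integral_mul_transferOp`), and a locally
integrable function is determined almost everywhere by its pairings with test functionals.
-/

set_option linter.unusedSectionVars false

namespace FunctionalWigner

/-! ### Single-mode displacement matrix elements -/

/-- The complex Hermite polynomials in two independent variables `x`, `y`. -/
def hermitePoly : ℕ → ℕ → ℂ → ℂ → ℂ
  | m, 0, x, _ => x ^ m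
  | m, n + 1, x, y => m * hermitePoly (m - 1) n x y - y * hermitePoly m n x y

lemma hermitePoly_zero_right (m : ℕ) (x y : ℂ) : hermitePoly m 0 x y = x ^ m := by
  cases m <;> rfl

lemma hermitePoly_succ_right (m n : ℕ) (x y : ℂ) :
    hermitePoly m (n + 1) x y = m * hermitePoly (m - 1) n x y - y * hermitePoly m n x y := by
  rw [hermitePoly]

lemma hermitePoly_succ_left (m n : ℕ) (x y : ℂ) :
    hermitePoly (m + 1) n x y = n * hermitePoly m (n - 1) x y + x * hermitePoly m n x y := by
  induction n generalizing m with
  | zero => simp [hermitePoly_zero_right, pow_succ, mul_comm]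
  | succ n ih =>
    rw [hermitePoly_succ_right (m + 1), ih m, hermitePoly_succ_right m]
    have h1 : (m : ℂ) * hermitePoly m n x y =
        m * (n * hermitePoly (m - 1) (n - 1) x y + x * hermitePoly (m - 1) n x y) := by
      cases m with
      | zero => simp
      | succ m => rw [Nat.add_sub_cancel, ← ih m]
    have h2 : (n : ℂ) * hermitePoly m n x y =
        n * (m * hermitePoly (m - 1) (n - 1) x y - y * hermitePoly m (n - 1) x y) := by
      cases n with
      | zero => simp
      | succ n => rw [Nat.add_sub_cancel, ← hermitePoly_succ_right]
    push_cast
    linear_combination h1 - h2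

lemma hermitePoly_zero_zero (m n : ℕ) :
    hermitePoly m n 0 0 = if m = n then (n.factorial : ℂ) else 0 := by
  induction n generalizing m with
  | zero => cases m <;> simp [hermitePoly_zero_right]
  | succ n ih =>
    rw [hermitePoly_succ_right, ih]
    cases m with
    | zero => simp
    | succ m =>
      by_cases h : m = n
      · subst h; simp [Nat.factorial_succ]
      · simp [h]

lemma hasDerivAt_hermitePoly {𝕜 : Type*} [NontriviallyNormedField 𝕜] [NormedAlgebra 𝕜 ℂ]
    (m n : ℕ) {x y : 𝕜 → ℂ} {x' y' : ℂ} {t : 𝕜} (hx : HasDerivAt x x' t) (hy : HasDerivAt y y' t) :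
    HasDerivAt (fun t => hermitePoly m n (x t) (y t))
      (m * hermitePoly (m - 1) n (x t) (y t) * x' - n * hermitePoly m (n - 1) (x t) (y t) * y')
      t := by
  induction n generalizing m with
  | zero =>
    simp only [hermitePoly_zero_right]
    convert! hx.pow m using 1
    simp
  | succ n ih =>
    simp only [hermitePoly_succ_right]
    convert! ((ih (m - 1)).const_mul (m : ℂ)).sub (hy.mul (ih m)) using 1
    have h2 : (n : ℂ) * hermitePoly m n (x t) (y t) =
        n * (m * hermitePoly (m - 1) (n - 1) (x t) (y t) - y t * hermitePoly m (n - 1) (x t) (y t)) := by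
      cases n with
      | zero => simp
      | succ n => rw [Nat.add_sub_cancel, ← hermitePoly_succ_right]
    push_cast
    linear_combination (-y') * h2

lemma exists_norm_hermitePoly_le (m n : ℕ) :
    ∃ (C : ℝ) (k : ℕ), 0 ≤ C ∧ ∀ z : ℂ, ‖hermitePoly m n z (conj z)‖ ≤ C * (1 + ‖z‖) ^ k := by
  induction n generalizing m with
  | zero =>
    refine ⟨1, m, zero_le_one, fun z => ?_⟩
    rw [hermitePoly_zero_right, norm_pow, one_mul]
    gcongr
    linarith
  | succ n ih =>
    obtain ⟨C, k, hC, h⟩ := ih (m - 1)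
    obtain ⟨C', k', hC', h'⟩ := ih m
    refine ⟨m * C + C', k + (k' + 1), by positivity, fun z => ?_⟩
    rw [hermitePoly_succ_right]
    have h1 : 1 ≤ 1 + ‖z‖ := by linarith [norm_nonneg z]
    calc _ ≤ m * ‖hermitePoly (m - 1) n z (conj z)‖ + ‖z‖ * ‖hermitePoly m n z (conj z)‖ := by
          refine (norm_sub_le _ _).trans (le_of_eq ?_)
          simp
      _ ≤ m * (C * (1 + ‖z‖) ^ (k + (k' + 1))) + C' * (1 + ‖z‖) ^ (k + (k' + 1)) := by
          refine add_le_add (mul_le_mul_of_nonneg_left ((h z).trans ?_) (Nat.cast_nonneg m)) ?_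
          · exact mul_le_mul_of_nonneg_left (pow_le_pow_right₀ h1 (by omega)) hC
          · calc _ ≤ (1 + ‖z‖) * (C' * (1 + ‖z‖) ^ k') :=
                  mul_le_mul (by linarith) (h' z) (norm_nonneg _) (by linarith)
              _ = C' * (1 + ‖z‖) ^ (k' + 1) := by ring
              _ ≤ _ := mul_le_mul_of_nonneg_left (pow_le_pow_right₀ h1 (by omega)) hC'
      _ = _ := by ring

lemma one_add_pow_le_exp (k : ℕ) {r : ℝ} (hr : 0 ≤ r) :
    (1 + r) ^ k ≤ (1 + k) ^ k * Real.exp (r ^ 2 / 4) := by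
  rcases Nat.eq_zero_or_pos k with rfl | hk
  · simpa using Real.one_le_exp (by positivity : 0 ≤ r ^ 2 / 4)
  have hk' : (0 : ℝ) < k := by exact_mod_cast hk
  have h : 1 + r ≤ (1 + k) * Real.exp (r ^ 2 / (4 * k)) := by
    have h1 : r ≤ k + r ^ 2 / (4 * k) := by
      rw [← sub_nonneg]
      have : k + r ^ 2 / (4 * k) - r = (r - 2 * k) ^ 2 / (4 * k) := by field_simp; ring
      rw [this]; positivity
    have h2 : r ^ 2 / (4 * k) + 1 ≤ Real.exp (r ^ 2 / (4 * k)) := Real.add_one_le_exp _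
    have h3 : 0 ≤ r ^ 2 / (4 * k) := by positivity
    nlinarith
  calc (1 + r) ^ k ≤ ((1 + k) * Real.exp (r ^ 2 / (4 * k))) ^ k := by gcongr
    _ = (1 + k) ^ k * Real.exp (r ^ 2 / 4) := by
      rw [mul_pow, ← Real.exp_nat_mul]
      congr 2
      field_simp

/-- The matrix element `⟨m| exp(x a† - y a) |n⟩` of a single mode; displacement operators
correspond to `y = conj x`. -/
noncomputable def dispElem (m n : ℕ) (x y : ℂ) : ℂ :=
  Complex.exp (-(x * y) / 2) *
    (((Real.sqrt m.factorial)⁻¹ * (Real.sqrt n.factorial)⁻¹ : ℝ) : ℂ) * hermitePoly m n x y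

lemma sqrt_mul_inv_sqrt_factorial_succ (m : ℕ) :
    (Real.sqrt (m + 1 : ℝ)) * (Real.sqrt (m + 1).factorial)⁻¹ = (Real.sqrt m.factorial)⁻¹ := by
  have h : Real.sqrt (m + 1 : ℝ) ≠ 0 := (Real.sqrt_pos.2 (by positivity)).ne'
  rw [Nat.factorial_succ, Nat.cast_mul, Real.sqrt_mul (by positivity), mul_inv, ← mul_assoc]
  push_cast
  rw [mul_inv_cancel₀ h, one_mul]

lemma sqrt_mul_inv_sqrt_factorial_pred (m : ℕ) :
    (Real.sqrt (m : ℝ)) * (Real.sqrt (m - 1).factorial)⁻¹ = m * (Real.sqrt m.factorial)⁻¹ := by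
  cases m with
  | zero => simp
  | succ m =>
    rw [Nat.add_sub_cancel, ← sqrt_mul_inv_sqrt_factorial_succ m]
    push_cast
    rw [← mul_assoc, Real.mul_self_sqrt (by positivity)]

/-- The right ladder relation `a† D = D (a† + y)`. -/
lemma dispElem_right_ladder (m n : ℕ) (x y : ℂ) :
    (Real.sqrt m : ℂ) * dispElem (m - 1) n x y =
      (Real.sqrt (n + 1 : ℝ) : ℂ) * dispElem m (n + 1) x y + y * dispElem m n x y := by
  have h1 := congrArg (fun r : ℝ => (r : ℂ)) (sqrt_mul_inv_sqrt_factorial_pred m)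
  have h2 := congrArg (fun r : ℝ => (r : ℂ)) (sqrt_mul_inv_sqrt_factorial_succ n)
  simp only [dispElem, hermitePoly_succ_right]
  push_cast at h1 h2 ⊢
  linear_combination
    (Complex.exp (-(x * y) / 2) * ((Real.sqrt n.factorial : ℂ))⁻¹ * hermitePoly (m - 1) n x y) * h1 -
    (Complex.exp (-(x * y) / 2) * ((Real.sqrt m.factorial : ℂ))⁻¹ *
      (m * hermitePoly (m - 1) n x y - y * hermitePoly m n x y)) * h2

/-- The left ladder relation `a D = D (a + x)`. -/
lemma dispElem_left_ladder (m n : ℕ) (x y : ℂ) :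
    (Real.sqrt (m + 1 : ℝ) : ℂ) * dispElem (m + 1) n x y =
      (Real.sqrt n : ℂ) * dispElem m (n - 1) x y + x * dispElem m n x y := by
  have h1 := congrArg (fun r : ℝ => (r : ℂ)) (sqrt_mul_inv_sqrt_factorial_pred n)
  have h2 := congrArg (fun r : ℝ => (r : ℂ)) (sqrt_mul_inv_sqrt_factorial_succ m)
  simp only [dispElem, hermitePoly_succ_left]
  push_cast at h1 h2 ⊢
  linear_combination
    -(Complex.exp (-(x * y) / 2) * ((Real.sqrt m.factorial : ℂ))⁻¹ * hermitePoly m (n - 1) x y) * h1 +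
    (Complex.exp (-(x * y) / 2) * ((Real.sqrt n.factorial : ℂ))⁻¹ *
      (n * hermitePoly m (n - 1) x y + x * hermitePoly m n x y)) * h2

lemma dispElem_zero_zero (m n : ℕ) : dispElem m n 0 0 = if m = n then 1 else 0 := by
  rw [dispElem, hermitePoly_zero_zero]
  split_ifs with h
  · subst h
    have : (Real.sqrt m.factorial : ℝ) ≠ 0 := (Real.sqrt_pos.2 (by positivity)).ne'
    simp only [mul_zero, neg_zero, zero_div, Complex.exp_zero, one_mul]
    rw [← mul_inv, Real.mul_self_sqrt (by positivity)]
    push_cast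
    exact inv_mul_cancel₀ (by exact_mod_cast m.factorial_ne_zero)
  · simp

lemma hasDerivAt_dispElem {𝕜 : Type*} [NontriviallyNormedField 𝕜] [NormedAlgebra 𝕜 ℂ]
    (m n : ℕ) {x y : 𝕜 → ℂ} {x' y' : ℂ} {t : 𝕜} (hx : HasDerivAt x x' t) (hy : HasDerivAt y y' t) :
    HasDerivAt (fun t => dispElem m n (x t) (y t))
      (((Real.sqrt m : ℂ) * dispElem (m - 1) n (x t) (y t) - y t / 2 * dispElem m n (x t) (y t)) * x'
        + (-((Real.sqrt n : ℂ) * dispElem m (n - 1) (x t) (y t))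
          - x t / 2 * dispElem m n (x t) (y t)) * y') t := by
  have h1 := congrArg (fun r : ℝ => (r : ℂ)) (sqrt_mul_inv_sqrt_factorial_pred n)
  have h2 := congrArg (fun r : ℝ => (r : ℂ)) (sqrt_mul_inv_sqrt_factorial_pred m)
  simp only [dispElem]
  have hE : HasDerivAt (fun t => Complex.exp (-(x t * y t) / 2))
      (Complex.exp (-(x t * y t) / 2) * (-(x' * y t + x t * y') / 2)) t := by
    have h := (((hx.mul hy).neg).div_const 2)
    exact (Complex.hasDerivAt_exp _).comp t h
  convert! (hE.mul_const _).mul (hasDerivAt_hermitePoly m n hx hy) using 1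
  push_cast at h1 h2 ⊢
  linear_combination
    (Complex.exp (-(x t * y t) / 2) * ((Real.sqrt n.factorial : ℂ))⁻¹ *
      hermitePoly (m - 1) n (x t) (y t)) * x' * h2 -
    (Complex.exp (-(x t * y t) / 2) * ((Real.sqrt m.factorial : ℂ))⁻¹ *
      hermitePoly m (n - 1) (x t) (y t)) * y' * h1

lemma exists_norm_dispElem_le (m n : ℕ) :
    ∃ C : ℝ, ∀ z : ℂ, ‖dispElem m n z (conj z)‖ ≤ C * Real.exp (-‖z‖ ^ 2 / 4) := by
  obtain ⟨C, k, hC, h⟩ := exists_norm_hermitePoly_le m n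
  refine ⟨(Real.sqrt m.factorial)⁻¹ * (Real.sqrt n.factorial)⁻¹ * (C * (1 + k) ^ k), fun z => ?_⟩
  have hexp : ‖Complex.exp (-(z * conj z) / 2)‖ = Real.exp (-‖z‖ ^ 2 / 2) := by
    rw [Complex.norm_exp, Complex.mul_conj, Complex.normSq_eq_norm_sq]
    congr 1
    rw [← Complex.ofReal_neg, show ((-(‖z‖ ^ 2) : ℝ) : ℂ) / 2 = ((-(‖z‖ ^ 2) / 2 : ℝ) : ℂ) by
      push_cast; ring, Complex.ofReal_re]
  rw [dispElem, norm_mul, norm_mul, hexp, Complex.norm_real, Real.norm_of_nonneg (by positivity)]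
  calc _ ≤ Real.exp (-‖z‖ ^ 2 / 2) * ((Real.sqrt m.factorial)⁻¹ * (Real.sqrt n.factorial)⁻¹) *
        (C * ((1 + k) ^ k * Real.exp (‖z‖ ^ 2 / 4))) := by
        gcongr
        exact (h z).trans (by gcongr; exact one_add_pow_le_exp k (norm_nonneg z))
    _ = (Real.sqrt m.factorial)⁻¹ * (Real.sqrt n.factorial)⁻¹ * (C * (1 + k) ^ k) *
        (Real.exp (-‖z‖ ^ 2 / 2) * Real.exp (‖z‖ ^ 2 / 4)) := by ring
    _ = _ := by rw [← Real.exp_add]; congr 2; ring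

lemma hasSum_shift {f g : ℕ → ℂ} {S : ℂ}
    (h : HasSum (fun m : ℕ => (Real.sqrt (m + 1 : ℝ) : ℂ) * f (m + 1) * g m) S) :
    HasSum (fun m : ℕ => (Real.sqrt m : ℂ) * g (m - 1) * f m) S := by
  rw [← hasSum_nat_add_iff' 1]
  simp only [Finset.range_one, Finset.sum_singleton, Nat.cast_zero, Real.sqrt_zero,
    Complex.ofReal_zero, zero_mul, sub_zero, Nat.add_sub_cancel]
  refine h.congr_fun fun m => ?_
  push_cast
  ring

lemma hasSum_conj_dispElem_zero (n : ℕ) (z : ℂ) :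
    HasSum (fun m => conj (dispElem m n z (conj z)) * dispElem m 0 z (conj z))
      (if n = 0 then 1 else 0) := by
  induction n with
  | zero =>
    have h := (Real.exp_eq_exp_ℝ ▸ NormedSpace.expSeries_div_hasSum_exp (‖z‖ ^ 2) :
      HasSum (fun n : ℕ => (‖z‖ ^ 2) ^ n / n.factorial) (Real.exp (‖z‖ ^ 2))).mul_left (Real.exp (-(‖z‖ ^ 2)))
    rw [← Real.exp_add, neg_add_cancel, Real.exp_zero] at h
    have h' := Complex.hasSum_ofReal.2 h
    simp only [if_true]
    refine (by simpa using h' : HasSum _ (1 : ℂ)).congr_fun fun m => ?_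
    rw [Complex.conj_mul', dispElem, hermitePoly_zero_right, norm_mul, norm_mul, Complex.norm_exp,
      Complex.norm_real, Complex.mul_conj, Complex.normSq_eq_norm_sq, norm_pow,
      Real.norm_of_nonneg (by positivity)]
    rw [show -((‖z‖ ^ 2 : ℝ) : ℂ) / 2 = ((-(‖z‖ ^ 2) / 2 : ℝ) : ℂ) by push_cast; ring,
      Complex.ofReal_re]
    norm_cast
    rw [mul_pow, mul_pow, ← Real.exp_nat_mul, mul_pow, inv_pow, Real.sq_sqrt (by positivity)]
    simp only [Nat.factorial_zero, Nat.cast_one, Real.sqrt_one, inv_one, one_pow, mul_one]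
    rw [show ((2 : ℕ) : ℝ) * (-(‖z‖ ^ 2) / 2) = -(‖z‖ ^ 2) by push_cast; ring]
    rw [← pow_mul, ← pow_mul, mul_comm m 2]
    ring
  | succ n ih =>
    have h1 : HasSum (fun m : ℕ => (Real.sqrt (m + 1 : ℝ) : ℂ) * dispElem (m + 1) 0 z (conj z) *
        conj (dispElem m n z (conj z))) (z * (if n = 0 then 1 else 0)) := by
      refine (ih.mul_left z).congr_fun fun m => ?_
      rw [dispElem_left_ladder]
      simp
      ring
    have h2 := (hasSum_shift (f := fun m => dispElem m 0 z (conj z))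
      (g := fun m => conj (dispElem m n z (conj z))) h1).sub (ih.mul_left z)
    rw [sub_self] at h2
    have hs : (Real.sqrt (n + 1 : ℝ) : ℂ) ≠ 0 := by
      exact_mod_cast (Real.sqrt_pos.2 (by positivity)).ne'
    have h3 := h2.mul_left ((Real.sqrt (n + 1 : ℝ) : ℂ)⁻¹)
    rw [mul_zero] at h3
    rw [if_neg (Nat.succ_ne_zero n)]
    refine h3.congr_fun fun m => ?_
    rw [eq_inv_mul_iff_mul_eq₀ hs]
    have := congrArg (starRingEnd ℂ) (dispElem_right_ladder m n z (conj z))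
    simp only [map_mul, map_add, Complex.conj_conj, Complex.conj_ofReal] at this
    linear_combination (-dispElem m 0 z (conj z)) * this

/-- The columns of a single-mode displacement operator are orthonormal: by the ladder relations,
the Gram matrix of the columns satisfies the recursion of the identity matrix. -/
lemma hasSum_conj_dispElem (n n' : ℕ) (z : ℂ) :
    HasSum (fun m => conj (dispElem m n z (conj z)) * dispElem m n' z (conj z))
      (if n = n' then 1 else 0) := by
  induction n' generalizing n with
  | zero => exact hasSum_conj_dispElem_zero n z
  | succ n' ih =>
    have h1 : HasSum (fun m : ℕ => (Real.sqrt (m + 1 : ℝ) : ℂ) *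
        conj (dispElem (m + 1) n z (conj z)) * dispElem m n' z (conj z))
        ((Real.sqrt n : ℂ) * (if n - 1 = n' then 1 else 0) +
          conj z * (if n = n' then 1 else 0)) := by
      refine (((ih (n - 1)).mul_left (Real.sqrt n : ℂ)).add ((ih n).mul_left (conj z))).congr_fun
        fun m => ?_
      have := congrArg (starRingEnd ℂ) (dispElem_left_ladder m n z (conj z))
      simp only [map_mul, map_add, Complex.conj_ofReal] at this
      linear_combination dispElem m n' z (conj z) * this
    have h2 := (hasSum_shift (f := fun m => conj (dispElem m n z (conj z)))
      (g := fun m => dispElem m n' z (conj z)) h1).sub ((ih n).mul_left (conj z))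
    rw [add_sub_cancel_right] at h2
    have hs : (Real.sqrt (n' + 1 : ℝ) : ℂ) ≠ 0 := by
      exact_mod_cast (Real.sqrt_pos.2 (by positivity)).ne'
    have hval : (if n = n' + 1 then (1 : ℂ) else 0) = (Real.sqrt (n' + 1 : ℝ) : ℂ)⁻¹ *
        ((Real.sqrt n : ℂ) * (if n - 1 = n' then 1 else 0)) := by
      cases n with
      | zero => simp
      | succ n =>
        by_cases h : n = n'
        · subst h
          push_cast
          simp [inv_mul_cancel₀ hs]
        · simp [h]
    rw [hval]
    refine (h2.mul_left _).congr_fun fun m => ?_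
    rw [eq_inv_mul_iff_mul_eq₀ hs]
    linear_combination (-conj (dispElem m n z (conj z))) * dispElem_right_ladder m n' z (conj z)

/-! ### Displacement operators on the Fock space -/

lemma pi_count_eq_count (ι : Type*) [Fintype ι] :
    Measure.pi (fun _ : ι => (Measure.count : Measure ℕ)) = Measure.count := by
  refine Measure.ext_of_singleton fun m => ?_
  rw [Measure.pi_singleton]
  simp

/-- A finite product of absolutely convergent series is the sum over all multi-indices of the
products of the terms. -/
lemma hasSum_fintype_prod {ι : Type*} [Fintype ι] {f : ι → ℕ → ℂ} {s : ι → ℂ}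
    (h : ∀ i, HasSum (f i) (s i)) :
    HasSum (fun m : ι → ℕ => ∏ i, f i (m i)) (∏ i, s i) := by
  have hi : ∀ i, Integrable (f i) Measure.count := fun i =>
    integrable_count_iff.2 (h i).summable.norm
  have hp := Integrable.fintype_prod (μ := fun _ : ι => (Measure.count : Measure ℕ)) hi
  have he := integral_fintype_prod_eq_prod (μ := fun _ : ι => (Measure.count : Measure ℕ)) f
  rw [pi_count_eq_count] at hp he
  have hs : Summable (fun m : ι → ℕ => ∏ i, f i (m i)) :=
    (integrable_count_iff.1 hp).of_norm
  have e1 : ∀ i, ∫ k, f i k ∂Measure.count = s i := fun i => by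
    rw [integral_countable (hi i)]
    simpa using (h i).tsum_eq
  rw [integral_countable hp] at he
  simp only [e1, measureReal_def, Measure.count_singleton, ENNReal.toReal_one, one_smul] at he
  rw [← he]
  exact hs.hasSum

section Modes

variable {C : ℕ} {M : Fin C → Type*} [∀ j, Fintype (M j)] [∀ j, DecidableEq (M j)]

/-- The matrix element of the displacement operator of several modes, as a function of the two
independent arguments `x`, `y` standing for `λ`, `λ^*`. -/
noncomputable def dispMat (m n : Occ M) (x y : Amp M) : ℂ :=
  ∏ i, dispElem (m i) (n i) (x i) (y i)

lemma dispMat_eq_mul (p : Mode M) (m n : Occ M) (x y : Amp M) :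
    dispMat m n x y = dispElem (m p) (n p) (x p) (y p) *
      ∏ i ∈ Finset.univ.erase p, dispElem (m i) (n i) (x i) (y i) :=
  (Finset.mul_prod_erase _ _ (Finset.mem_univ p)).symm

lemma dispMat_eq_mul_of_eq (p : Mode M) {m m' n n' : Occ M} (x y : Amp M)
    (hm : ∀ i ≠ p, m' i = m i) (hn : ∀ i ≠ p, n' i = n i) :
    dispMat m' n' x y = dispElem (m' p) (n' p) (x p) (y p) *
      ∏ i ∈ Finset.univ.erase p, dispElem (m i) (n i) (x i) (y i) := by
  rw [dispMat_eq_mul p]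
  congr 1
  refine Finset.prod_congr rfl fun i hi => ?_
  rw [hm i (Finset.ne_of_mem_erase hi), hn i (Finset.ne_of_mem_erase hi)]

lemma sub_single_apply_of_ne {p i : Mode M} (m : Occ M) (h : i ≠ p) :
    (m - Pi.single p 1 : Occ M) i = m i := by simp [h]

lemma add_single_apply_of_ne {p i : Mode M} (m : Occ M) (h : i ≠ p) :
    (m + Pi.single p 1 : Occ M) i = m i := by simp [h]

lemma dispMat_sub_left (p : Mode M) (m n : Occ M) (x y : Amp M) :
    dispMat (m - Pi.single p 1) n x y = dispElem (m p - 1) (n p) (x p) (y p) *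
      ∏ i ∈ Finset.univ.erase p, dispElem (m i) (n i) (x i) (y i) := by
  rw [dispMat_eq_mul_of_eq p x y (fun i => sub_single_apply_of_ne m) (fun i _ => rfl)]
  simp

lemma dispMat_sub_right (p : Mode M) (m n : Occ M) (x y : Amp M) :
    dispMat m (n - Pi.single p 1) x y = dispElem (m p) (n p - 1) (x p) (y p) *
      ∏ i ∈ Finset.univ.erase p, dispElem (m i) (n i) (x i) (y i) := by
  rw [dispMat_eq_mul_of_eq p x y (fun i _ => rfl) (fun i => sub_single_apply_of_ne n)]
  simp

lemma dispMat_add_left (p : Mode M) (m n : Occ M) (x y : Amp M) :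
    dispMat (m + Pi.single p 1) n x y = dispElem (m p + 1) (n p) (x p) (y p) *
      ∏ i ∈ Finset.univ.erase p, dispElem (m i) (n i) (x i) (y i) := by
  rw [dispMat_eq_mul_of_eq p x y (fun i => add_single_apply_of_ne m) (fun i _ => rfl)]
  simp

lemma dispMat_add_right (p : Mode M) (m n : Occ M) (x y : Amp M) :
    dispMat m (n + Pi.single p 1) x y = dispElem (m p) (n p + 1) (x p) (y p) *
      ∏ i ∈ Finset.univ.erase p, dispElem (m i) (n i) (x i) (y i) := by
  rw [dispMat_eq_mul_of_eq p x y (fun i _ => rfl) (fun i => add_single_apply_of_ne n)]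
  simp

/-- The right ladder relation `a_p† D = D (a_p† + y_p)`. -/
lemma create_dispMat (p : Mode M) (m n : Occ M) (x y : Amp M) :
    (Real.sqrt (m p) : ℂ) * dispMat (m - Pi.single p 1) n x y =
      (Real.sqrt (n p + 1 : ℝ) : ℂ) * dispMat m (n + Pi.single p 1) x y
        + y p * dispMat m n x y := by
  rw [dispMat_sub_left, dispMat_add_right, dispMat_eq_mul p m n]
  linear_combination (∏ i ∈ Finset.univ.erase p, dispElem (m i) (n i) (x i) (y i)) *
    dispElem_right_ladder (m p) (n p) (x p) (y p)

/-- The left ladder relation `a_p D = D (a_p + x_p)`. -/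
lemma annihilate_dispMat (p : Mode M) (m n : Occ M) (x y : Amp M) :
    (Real.sqrt (m p + 1 : ℝ) : ℂ) * dispMat (m + Pi.single p 1) n x y =
      (Real.sqrt (n p) : ℂ) * dispMat m (n - Pi.single p 1) x y
        + x p * dispMat m n x y := by
  rw [dispMat_sub_right, dispMat_add_left, dispMat_eq_mul p m n]
  linear_combination (∏ i ∈ Finset.univ.erase p, dispElem (m i) (n i) (x i) (y i)) *
    dispElem_left_ladder (m p) (n p) (x p) (y p)

lemma hasDerivAt_dispMat {𝕜 : Type*} [NontriviallyNormedField 𝕜] [NormedAlgebra 𝕜 ℂ]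
    (m n : Occ M) {x y : 𝕜 → Amp M} {x' y' : Amp M} {t : 𝕜}
    (hx : ∀ i, HasDerivAt (fun t => x t i) (x' i) t)
    (hy : ∀ i, HasDerivAt (fun t => y t i) (y' i) t) :
    HasDerivAt (fun t => dispMat m n (x t) (y t))
      (∑ p, (((Real.sqrt (m p) : ℂ) * dispMat (m - Pi.single p 1) n (x t) (y t)
          - y t p / 2 * dispMat m n (x t) (y t)) * x' p
        + (-((Real.sqrt (n p) : ℂ) * dispMat m (n - Pi.single p 1) (x t) (y t))
          - x t p / 2 * dispMat m n (x t) (y t)) * y' p)) t := by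
  have h := HasDerivAt.fun_finsetProd (u := Finset.univ)
    fun i _ => hasDerivAt_dispElem (m i) (n i) (hx i) (hy i)
  unfold dispMat at h ⊢
  convert! h using 1
  refine Finset.sum_congr rfl fun p _ => ?_
  have e1 := dispMat_sub_left p m n (x t) (y t)
  have e2 := dispMat_sub_right p m n (x t) (y t)
  have e3 := dispMat_eq_mul p m n (x t) (y t)
  unfold dispMat at e1 e2 e3
  rw [e1, e2, e3, smul_eq_mul]
  ring

lemma dispMat_zero (m n : Occ M) : dispMat m n 0 0 = if m = n then 1 else 0 := by
  simp only [dispMat, Pi.zero_apply, dispElem_zero_zero]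
  rw [Finset.prod_ite_zero]
  simp [funext_iff]

/-- The Gram matrix of the columns of the displacement operator is the identity. -/
lemma hasSum_conj_dispMat (n n' : Occ M) (l : Amp M) :
    HasSum (fun m => conj (dispMat m n l (fun i => conj (l i))) *
        dispMat m n' l (fun i => conj (l i))) (if n = n' then 1 else 0) := by
  have h := hasSum_fintype_prod fun i => hasSum_conj_dispElem (n i) (n' i) (l i)
  have e : (∏ i, if n i = n' i then (1 : ℂ) else 0) = if n = n' then 1 else 0 := by
    rw [Finset.prod_ite_zero]
    simp [funext_iff]
  rw [e] at h
  refine h.congr_fun fun m => ?_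
  simp [dispMat, Finset.prod_mul_distrib]

/-- The exponent `∑ i, (x_i a_i† - y_i a_i)` of the displacement operator. -/
noncomputable def dispExponent (x y : Amp M) (c : Occ M → ℂ) : Occ M → ℂ :=
  fun m => ∑ i, (x i * create i c m - y i * annihilate i c m)

lemma hasDerivAt_dispExponent (x y : Amp M) {F : ℂ → Occ M → ℂ} {F' : Occ M → ℂ} {t : ℂ}
    (h : ∀ m, HasDerivAt (fun t => F t m) (F' m) t) (m : Occ M) :
    HasDerivAt (fun t => dispExponent x y (F t) m) (dispExponent x y F' m) t := by
  simp only [dispExponent, create, annihilate]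
  refine HasDerivAt.fun_sum fun i _ => ?_
  exact (((h _).const_mul _).const_mul _).sub (((h _).const_mul _).const_mul _)

lemma hasDerivAt_iterate_dispExponent (x y : Amp M) (k : ℕ) {F : ℂ → Occ M → ℂ} {F' : Occ M → ℂ}
    {t : ℂ} (h : ∀ m, HasDerivAt (fun t => F t m) (F' m) t) (m : Occ M) :
    HasDerivAt (fun t => (dispExponent x y)^[k] (F t) m) ((dispExponent x y)^[k] F' m) t := by
  induction k generalizing m with
  | zero => exact h m
  | succ k ih =>
    simp only [Function.iterate_succ_apply']
    exact hasDerivAt_dispExponent x y ih m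

/-- Along `t ↦ (t x, t y)` the columns of the displacement matrix solve `F' = X F`. -/
lemma hasDerivAt_dispMat_smul (n : Occ M) (x y : Amp M) (t : ℂ) (m : Occ M) :
    HasDerivAt (fun t : ℂ => dispMat m n (t • x) (t • y))
      (dispExponent x y (fun m => dispMat m n (t • x) (t • y)) m) t := by
  have hid : ∀ c : ℂ, HasDerivAt (fun t : ℂ => t * c) c t := fun c => by
    simpa using (hasDerivAt_id t).mul_const c
  have h := hasDerivAt_dispMat (𝕜 := ℂ) m n (x := fun t => t • x) (y := fun t => t • y)
    (x' := x) (y' := y) (t := t) (fun i => hid (x i)) (fun i => hid (y i))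
  convert! h using 1
  refine Finset.sum_congr rfl fun p _ => ?_
  simp only [create, annihilate]
  rw [annihilate_dispMat]
  simp only [Pi.smul_apply, smul_eq_mul]
  ring

/-- The exponential series of the exponent sums to the displacement matrix: the matrix elements
along `t ↦ (t x, t y)` are entire, and the series is their Taylor series at `0`. -/
lemma hasSum_dispExponent (m n : Occ M) (x y : Amp M) :
    HasSum (fun k : ℕ => ((k.factorial : ℂ))⁻¹ *
      ((dispExponent x y)^[k] (fun m => if m = n then 1 else 0)) m) (dispMat m n x y) := by
  have hd := hasDerivAt_dispMat_smul n x y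
  have hit : ∀ k, iteratedDeriv k (fun t : ℂ => dispMat m n (t • x) (t • y)) =
      fun t => (dispExponent x y)^[k] (fun m => dispMat m n (t • x) (t • y)) m := by
    intro k
    induction k with
    | zero => simp
    | succ k ih =>
      rw [iteratedDeriv_succ, ih]
      funext t
      rw [(hasDerivAt_iterate_dispExponent x y k (hd t) m).deriv, Function.iterate_succ_apply]
  have hdiff : Differentiable ℂ (fun t : ℂ => dispMat m n (t • x) (t • y)) :=
    fun t => (hd t m).differentiableAt
  have h := Complex.hasSum_taylorSeries_of_entire hdiff 0 1
  simp only [one_smul, sub_zero, one_pow] at h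
  refine h.congr_fun fun k => ?_
  rw [hit k]
  simp only [zero_smul, smul_eq_mul, dispMat_zero]

/-- A column of the displacement operator as a vector of the Fock space. -/
noncomputable def dispCol (l : Amp M) (n : Occ M) : Fock M :=
  ⟨fun m => dispMat m n l (fun i => conj (l i)), by
    refine memℓp_gen ?_
    have h := (hasSum_conj_dispMat n n l).summable.norm
    refine h.congr fun m => ?_
    rw [norm_mul, RCLike.norm_conj, ENNReal.toReal_ofNat, Real.rpow_two, sq]⟩

lemma dispCol_apply (l : Amp M) (n m : Occ M) :
    dispCol l n m = dispMat m n l (fun i => conj (l i)) := rfl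

lemma orthonormal_dispCol (l : Amp M) : Orthonormal ℂ (dispCol l) := by
  classical
  rw [orthonormal_iff_ite]
  intro n n'
  rw [lp.inner_eq_tsum]
  refine Eq.trans ?_ (hasSum_conj_dispMat n n' l).tsum_eq
  refine tsum_congr fun m => ?_
  rw [RCLike.inner_apply, mul_comm]
  rfl

/-- The displacement operator `exp ∑ i, (λ_i a_i† - λ_i^* a_i)`, the isometry whose columns are
`dispCol`. -/
noncomputable def dispOp (l : Amp M) : Fock M →L[ℂ] Fock M :=
  ((orthonormal_dispCol l).orthogonalFamily.linearIsometry).toContinuousLinearMap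

lemma dispOp_numberState (l : Amp M) (n : Occ M) : dispOp l (numberState n) = dispCol l n := by
  classical
  have h := (orthonormal_dispCol l).orthogonalFamily.linearIsometry_apply_single (i := n) (1 : ℂ)
  rw [LinearIsometry.toSpanSingleton_apply, one_smul] at h
  rw [← h]
  simp only [dispOp, numberState, LinearIsometry.coe_toContinuousLinearMap]

lemma numberState_apply (n m : Occ M) : (numberState n : Fock M) m = if m = n then 1 else 0 := by
  rw [numberState, lp.single_apply, Pi.single_apply]

lemma hasSum_numberState (v : Fock M) : HasSum (fun n => v n • numberState n) v := by
  have h := lp.hasSum_single (by norm_num : (2 : ENNReal) ≠ ⊤) v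
  refine h.congr_fun fun n => ?_
  rw [numberState, ← lp.single_smul, smul_eq_mul, mul_one]

lemma hasSum_apply_numberState (T : Fock M →L[ℂ] Fock M) (v : Fock M) (m : Occ M) :
    HasSum (fun n => v n * T (numberState n) m) (T v m) := by
  have h := ((hasSum_numberState v).mapL T).mapL (lp.evalCLM ℂ (fun _ : Occ M => ℂ) 2 m)
  refine HasSum.congr_fun (f := fun n => (lp.evalCLM ℂ (fun _ : Occ M => ℂ) 2 m)
    (T (v n • numberState n))) h fun n => ?_
  rw [map_smul, map_smul, smul_eq_mul]
  rfl

lemma ext_numberState {S T : Fock M →L[ℂ] Fock M}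
    (h : ∀ n m, S (numberState n) m = T (numberState n) m) : S = T := by
  ext v m
  exact ((hasSum_apply_numberState S v m).congr_fun fun n => by rw [h n m]).unique
    (hasSum_apply_numberState T v m)

end Modes

/-! ### Coordinate integrals in terms of modes -/

section Modes

variable {D C : ℕ} {M : Fin C → Type*} [∀ j, Fintype (M j)] [∀ j, DecidableEq (M j)]

lemma dispOp_mul_of_disjoint {l u : Amp M} (h : ∀ i, l i = 0 ∨ u i = 0) :
    dispOp l * dispOp u = dispOp (l + u) := by
  refine ext_numberState fun n m => ?_
  rw [mul_apply_eq_comp, dispOp_numberState, dispOp_numberState]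
  -- only one intermediate number state contributes: modes not displaced by `l` agree with `m`,
  -- the others are not displaced by `u` and agree with `n`
  set p : Occ M := fun i => if l i = 0 then m i else n i with hp
  refine (hasSum_apply_numberState (dispOp l) (dispCol u n) m).unique ?_
  have hval : dispCol (l + u) n m = dispCol u n p * dispOp l (numberState p) m := by
    rw [dispOp_numberState, dispCol_apply, dispCol_apply, dispCol_apply, dispMat, dispMat, dispMat,
      ← Finset.prod_mul_distrib]
    refine Finset.prod_congr rfl fun i _ => ?_
    by_cases hl : l i = 0
    · simp [hp, hl, dispElem_zero_zero]
    · simp [hp, hl, (h i).resolve_left hl, dispElem_zero_zero]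
  rw [hval]
  refine hasSum_single p fun q hq => ?_
  obtain ⟨i, hi⟩ := Function.ne_iff.1 hq
  rw [dispOp_numberState, dispCol_apply, dispCol_apply, dispMat, dispMat,
    ← Finset.prod_mul_distrib]
  refine Finset.prod_eq_zero (Finset.mem_univ i) ?_
  by_cases hl : l i = 0
  · have : m i ≠ q i := fun e => hi (by simp [hp, hl, e])
    simp [hl, dispElem_zero_zero, this]
  · have : q i ≠ n i := fun e => hi (by simp [hp, hl, e])
    simp [(h i).resolve_left hl, dispElem_zero_zero, this]

/-- The amplitudes `l` of the components in `S`, the other ones being replaced by `0`. -/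
def restrictAmp (S : Finset (Fin C)) (l : Amp M) : Amp M := fun i => if i.1 ∈ S then l i else 0

lemma restrictAmp_univ (l : Amp M) : restrictAmp Finset.univ l = l := by
  funext i; simp [restrictAmp]

lemma dispOp_zero : dispOp (0 : Amp M) = 1 := by
  refine ext_numberState fun n m => ?_
  have : (fun i : Mode M => conj ((0 : Amp M) i)) = 0 := by funext i; simp
  rw [dispOp_numberState, dispCol_apply, this, dispMat_zero, one_apply_eq_self,
    numberState_apply]

lemma prod_map_dispOp (l : Amp M) (L : List (Fin C)) (hL : L.Nodup) :
    (L.map fun j => dispOp (restrictAmp {j} l)).prod = dispOp (restrictAmp L.toFinset l) := by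
  induction L with
  | nil =>
    have : restrictAmp ∅ l = 0 := by funext i; simp [restrictAmp]
    simp [this, dispOp_zero]
  | cons j L ih =>
    rw [List.nodup_cons] at hL
    rw [List.map_cons, List.prod_cons, ih hL.2, dispOp_mul_of_disjoint]
    · congr 1
      funext i
      by_cases h : i.1 = j
      · have : i.1 ∉ L := h ▸ hL.1
        simp [restrictAmp, h, hL.1]
      · simp [restrictAmp, h]
    · intro i
      by_cases h : i.1 = j
      · right; simp [restrictAmp, h, hL.1]
      · left; simp [restrictAmp, h]

lemma prod_ofFn_dispOp (l : Amp M) :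
    (List.ofFn fun j => dispOp (restrictAmp {j} l)).prod = dispOp l := by
  rw [List.ofFn_eq_map, prod_map_dispOp l _ (List.nodup_finRange C)]
  congr 1
  rw [show (List.finRange C).toFinset = Finset.univ by ext; simp, restrictAmp_univ]

namespace RestrictedBasis

variable (b : RestrictedBasis D M)

/-- The overlap `∫ dx φ_{j,p}^* φ_{k,q}` of two mode functions. -/
noncomputable def overlap (j k : Fin C) (p : M j) (q : M k) : ℂ :=
  ∫ x in b.region, conj (b.φ j p x) * b.φ k q x

lemma integrable_conj_mul (j k : Fin C) (p : M j) (q : M k) :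
    Integrable (fun x => conj (b.φ j p x) * b.φ k q x) (volume.restrict b.region) :=
  MemLp.integrable_mul (p := 2) (q := 2) (b.memLp j p).star (b.memLp k q)

/-- Integrals over `x` of bilinear expressions in the mode functions reduce to overlaps. -/
lemma integral_sum_sum (j k : Fin C) (c : M j → M k → ℂ) :
    ∫ x in b.region, ∑ p, ∑ q, conj (b.φ j p x) * b.φ k q x * c p q =
      ∑ p, ∑ q, b.overlap j k p q * c p q := by
  rw [integral_finsetSum]
  · refine Finset.sum_congr rfl fun p _ => ?_
    rw [integral_finsetSum]
    · refine Finset.sum_congr rfl fun q _ => ?_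
      rw [integral_mul_const, overlap]
    · exact fun q _ => (b.integrable_conj_mul j k p q).mul_const _
  · exact fun p _ => integrable_finsetSum _ fun q _ => (b.integrable_conj_mul j k p q).mul_const _

lemma overlap_self (j : Fin C) (p q : M j) : b.overlap j j p q = if p = q then 1 else 0 :=
  b.orthonormal j p q

lemma bilinearOp_apply (j k : Fin C) (c : Occ M → ℂ) (m : Occ M) :
    b.bilinearOp j k c m = ∑ p, ∑ q, b.overlap j k p q *
      create ⟨j, p⟩ (annihilate ⟨k, q⟩ c) m := by
  rw [← integral_sum_sum, bilinearOp]
  congr 1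
  funext x
  simp only [fieldOpAdj, fieldOp, create, Finset.mul_sum]
  refine Finset.sum_congr rfl fun p _ => Finset.sum_congr rfl fun q _ => ?_
  ring

lemma displacementExponent_eq (j : Fin C) (l : Amp M) :
    b.displacementExponent j l =
      dispExponent (restrictAmp {j} l) (fun i => conj (restrictAmp {j} l i)) := by
  funext c m
  have h : ∀ x, b.field j l x * b.fieldOpAdj j x c m - conj (b.field j l x) * b.fieldOp j x c m =
      ∑ p, ∑ q, conj (b.φ j p x) * b.φ j q x *
        (l ⟨j, q⟩ * create ⟨j, p⟩ c m - conj (l ⟨j, p⟩) * annihilate ⟨j, q⟩ c m) := by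
    intro x
    simp only [field, fieldOpAdj, fieldOp, map_sum, map_mul, Finset.sum_mul_sum, mul_sub,
      Finset.sum_sub_distrib]
    congr 1
    · rw [Finset.sum_comm]
      refine Finset.sum_congr rfl fun p _ => Finset.sum_congr rfl fun q _ => ?_
      ring
    · refine Finset.sum_congr rfl fun p _ => Finset.sum_congr rfl fun q _ => ?_
      ring
  rw [displacementExponent]
  simp only [h]
  rw [integral_sum_sum]
  simp only [overlap_self, ite_mul, one_mul, zero_mul, Finset.sum_ite_eq, Finset.mem_univ, if_true]
  rw [dispExponent, Fintype.sum_sigma, Finset.sum_eq_single j]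
  · simp [restrictAmp]
  · intro k _ hk
    refine Finset.sum_eq_zero fun q _ => ?_
    simp [restrictAmp, hk]
  · simp

/-- The explicit displacement operators satisfy the defining exponential series. -/
lemma isDisplacement_dispOp :
    b.IsDisplacement fun j l => dispOp (restrictAmp {j} l) := by
  intro j l n m
  rw [displacementExponent_eq, dispOp_numberState, dispCol_apply]
  rw [show ((numberState n : Fock M) : Occ M → ℂ) = fun m => if m = n then 1 else 0 from
    funext (numberState_apply n)]
  exact hasSum_dispExponent m n _ _

lemma IsDisplacement.prod_eq {b : RestrictedBasis D M}
    {U : Fin C → Amp M → (Fock M →L[ℂ] Fock M)} (hU : b.IsDisplacement U) (l : Amp M) :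
    (List.ofFn fun j => U j l).prod = dispOp l := by
  rw [← prod_ofFn_dispOp]
  congr 2
  funext j
  exact ext_numberState fun n m => (hU j l n m).unique (b.isDisplacement_dispOp j l n m)

end RestrictedBasis

/-- The kernel `exp ∑ i, (-λ_i α_i^* + λ_i^* α_i)` of the symplectic Fourier transform. -/
noncomputable def symplKernel (l α : Amp M) : ℂ :=
  Complex.exp (∑ i, (-(l i * conj (α i)) + conj (l i) * α i))

lemma RestrictedBasis.prod_displacementFunctional (b : RestrictedBasis D M) (l α : Amp M) :
    ∏ j, b.displacementFunctional j l α = symplKernel l α := by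
  simp only [displacementFunctional]
  rw [← Complex.exp_sum, symplKernel, Fintype.sum_sigma]
  congr 1
  refine Finset.sum_congr rfl fun j _ => ?_
  have h : ∀ x, -(b.field j l x * conj (b.field j α x)) + conj (b.field j l x) * b.field j α x =
      ∑ p, ∑ q, conj (b.φ j p x) * b.φ j q x *
        (-(l ⟨j, q⟩ * conj (α ⟨j, p⟩)) + conj (l ⟨j, p⟩) * α ⟨j, q⟩) := by
    intro x
    simp only [field, map_sum, map_mul, Finset.sum_mul_sum, mul_add,
      Finset.sum_add_distrib, ← Finset.sum_neg_distrib]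
    congr 1
    · rw [Finset.sum_comm]
      refine Finset.sum_congr rfl fun p _ => Finset.sum_congr rfl fun q _ => ?_
      ring
    · refine Finset.sum_congr rfl fun p _ => Finset.sum_congr rfl fun q _ => ?_
      ring
  simp only [h]
  rw [b.integral_sum_sum]
  simp only [b.overlap_self, ite_mul, one_mul, zero_mul, Finset.sum_ite_eq, Finset.mem_univ,
    if_true]

end Modes

/-! ### Wirtinger derivatives -/

section Modes

variable {D C : ℕ} {M : Fin C → Type*} [∀ j, Fintype (M j)] [∀ j, DecidableEq (M j)]

lemma lineDeriv_single_one (i : Mode M) (f : Amp M → ℂ) (α : Amp M) :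
    lineDeriv ℝ f α (Pi.single i 1) = wirtinger i f α + wirtingerConj i f α := by
  simp only [wirtinger, wirtingerConj]; ring

lemma lineDeriv_single_I (i : Mode M) (f : Amp M → ℂ) (α : Amp M) :
    lineDeriv ℝ f α (Pi.single i Complex.I) =
      Complex.I * (wirtinger i f α - wirtingerConj i f α) := by
  simp only [wirtinger, wirtingerConj]
  linear_combination (lineDeriv ℝ f α (Pi.single i Complex.I)) * Complex.I_mul_I

lemma lineDeriv_conj {f : Amp M → ℂ} {α : Amp M} (hf : DifferentiableAt ℝ f α) (v : Amp M) :
    lineDeriv ℝ (fun β => conj (f β)) α v = conj (lineDeriv ℝ f α v) := by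
  have h := Complex.conjCLE.toContinuousLinearMap.hasFDerivAt.comp α hf.hasFDerivAt
  have h' := (h.hasLineDerivAt v).lineDeriv
  rw [hf.lineDeriv_eq_fderiv]
  exact h'

lemma wirtinger_conj {f : Amp M → ℂ} {α : Amp M} (hf : DifferentiableAt ℝ f α) (i : Mode M) :
    wirtinger i (fun β => conj (f β)) α = conj (wirtingerConj i f α) := by
  simp only [wirtinger, wirtingerConj, lineDeriv_conj hf]
  simp only [map_div₀, map_add, map_mul, map_ofNat, Complex.conj_I]
  ring

lemma wirtingerConj_conj {f : Amp M → ℂ} {α : Amp M} (hf : DifferentiableAt ℝ f α) (i : Mode M) :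
    wirtingerConj i (fun β => conj (f β)) α = conj (wirtinger i f α) := by
  simp only [wirtinger, wirtingerConj, lineDeriv_conj hf]
  simp only [map_div₀, map_sub, map_mul, map_ofNat, Complex.conj_I]
  ring

lemma integral_mul_lineDeriv {f g : Amp M → ℂ} (hf : Differentiable ℝ f) (hg : Differentiable ℝ g)
    (hfg : Integrable fun α => f α * g α) {v : Amp M}
    (h1 : Integrable fun α => lineDeriv ℝ f α v * g α)
    (h2 : Integrable fun α => f α * lineDeriv ℝ g α v) :
    ∫ α, f α * lineDeriv ℝ g α v = -∫ α, lineDeriv ℝ f α v * g α := by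
  have e1 : ∀ α, lineDeriv ℝ f α v = fderiv ℝ f α v := fun α => (hf α).lineDeriv_eq_fderiv
  have e2 : ∀ α, lineDeriv ℝ g α v = fderiv ℝ g α v := fun α => (hg α).lineDeriv_eq_fderiv
  simp only [e1, e2] at h1 h2 ⊢
  exact integral_mul_fderiv_eq_neg_fderiv_mul_of_integrable h1 h2 hfg (fun x _ => hf x)
    (fun x _ => hg x)

/-- Integration by parts for Wirtinger derivatives; `f`, `g` need only be differentiable, with
integrable products. -/
lemma integral_mul_wirtinger_and_conj {f g : Amp M → ℂ} (hf : Differentiable ℝ f)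
    (hg : Differentiable ℝ g) (hfg : Integrable fun α => f α * g α) (i : Mode M)
    (h1 : Integrable fun α => wirtinger i f α * g α)
    (h2 : Integrable fun α => wirtingerConj i f α * g α)
    (h3 : Integrable fun α => f α * wirtinger i g α)
    (h4 : Integrable fun α => f α * wirtingerConj i g α) :
    (∫ α, f α * wirtinger i g α = -∫ α, wirtinger i f α * g α) ∧
    (∫ α, f α * wirtingerConj i g α = -∫ α, wirtingerConj i f α * g α) := by
  have k1 : Integrable fun α => lineDeriv ℝ f α (Pi.single i 1) * g α := by
    simp only [lineDeriv_single_one, add_mul]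
    exact h1.add h2
  have k2 : Integrable fun α => f α * lineDeriv ℝ g α (Pi.single i 1) := by
    simp only [lineDeriv_single_one, mul_add]
    exact h3.add h4
  have k3 : Integrable fun α => lineDeriv ℝ f α (Pi.single i Complex.I) * g α := by
    refine ((h1.sub h2).const_mul Complex.I).congr (ae_of_all _ fun α => ?_)
    simp only [lineDeriv_single_I, Pi.sub_apply]; ring
  have k4 : Integrable fun α => f α * lineDeriv ℝ g α (Pi.single i Complex.I) := by
    refine ((h3.sub h4).const_mul Complex.I).congr (ae_of_all _ fun α => ?_)
    simp only [lineDeriv_single_I, Pi.sub_apply]; ring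
  have e1 := integral_mul_lineDeriv hf hg hfg k1 k2
  have e2 := integral_mul_lineDeriv hf hg hfg k3 k4
  simp only [lineDeriv_single_one, mul_add, add_mul] at e1
  rw [integral_add h3 h4, integral_add h1 h2] at e1
  have e3 : ∫ α, f α * lineDeriv ℝ g α (Pi.single i Complex.I) =
      Complex.I * (∫ α, f α * wirtinger i g α - f α * wirtingerConj i g α) := by
    rw [← integral_const_mul]
    congr 1; funext α
    rw [lineDeriv_single_I]; ring
  have e4 : ∫ α, lineDeriv ℝ f α (Pi.single i Complex.I) * g α =
      Complex.I * (∫ α, wirtinger i f α * g α - wirtingerConj i f α * g α) := by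
    rw [← integral_const_mul]
    congr 1; funext α
    rw [lineDeriv_single_I]; ring
  rw [e3, e4, integral_sub h3 h4, integral_sub h1 h2, ← mul_neg] at e2
  have e5 := mul_left_cancel₀ Complex.I_ne_zero e2
  constructor
  · linear_combination (e1 + e5) / 2
  · linear_combination (e1 - e5) / 2

/-! ### Orthogonality of the matrix elements of the displacement operators -/

/-- The matrix element `⟨m| D(λ) |n⟩` as a function of the amplitudes `λ`. -/
noncomputable def dispFun (m n : Occ M) (l : Amp M) : ℂ := dispMat m n l (fun i => conj (l i))

lemma differentiable_hermitePoly_conj (m n : ℕ) :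
    Differentiable ℝ fun z : ℂ => hermitePoly m n z (conj z) := by
  induction n generalizing m with
  | zero => simp only [hermitePoly_zero_right]; fun_prop
  | succ n ih =>
    simp only [hermitePoly_succ_right]
    exact ((ih _).const_mul _).sub (Complex.conjCLE.differentiable.mul (ih _))

lemma differentiable_dispElem_conj (m n : ℕ) :
    Differentiable ℝ fun z : ℂ => dispElem m n z (conj z) := by
  simp only [dispElem]
  refine (Differentiable.mul_const ?_ _).mul (differentiable_hermitePoly_conj m n)
  have hconj : Differentiable ℝ fun z : ℂ => conj z := Complex.conjCLE.differentiable
  fun_prop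

lemma differentiable_dispFun (m n : Occ M) : Differentiable ℝ (dispFun m n) := by
  intro l
  have h : ∀ i, HasFDerivAt (fun l : Amp M => dispElem (m i) (n i) (l i) (conj (l i)))
      (fderiv ℝ (fun l : Amp M => dispElem (m i) (n i) (l i) (conj (l i))) l) l := fun i =>
    DifferentiableAt.hasFDerivAt ((differentiable_dispElem_conj (m i) (n i)).comp
      (differentiable_apply (𝕜 := ℝ) (F' := fun _ : Mode M => ℂ) i) l)
  have h2 := HasFDerivAt.finsetProd (u := Finset.univ) fun i _ => h i
  unfold dispFun dispMat
  exact h2.differentiableAt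

lemma integrable_dispElem_conj (m n : ℕ) :
    Integrable fun z : ℂ => dispElem m n z (conj z) := by
  obtain ⟨C, hC⟩ := exists_norm_dispElem_le m n
  have hg : Integrable fun z : ℂ => C * Real.exp (-‖z‖ ^ 2 / 4) := by
    refine Integrable.const_mul ?_ C
    have h := (GaussianFourier.integrable_cexp_neg_mul_sq_norm_add (V := ℂ)
      (b := 1 / 4) (by norm_num) 0 0).norm
    refine h.congr (ae_of_all _ fun z => ?_)
    simp only [inner_zero_left, Complex.ofReal_zero, mul_zero, add_zero, Complex.norm_exp]
    congr 1
    rw [show (-(1 / 4) * (‖z‖ : ℂ) ^ 2) = ((-‖z‖ ^ 2 / 4 : ℝ) : ℂ) by push_cast; ring,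
      Complex.ofReal_re]
  exact hg.mono' (differentiable_dispElem_conj m n).continuous.aestronglyMeasurable
    (ae_of_all _ hC)

lemma integrable_dispFun (m n : Occ M) : Integrable (dispFun m n) :=
  Integrable.fintype_prod (f := fun i z => dispElem (m i) (n i) z (conj z))
    fun i => integrable_dispElem_conj (m i) (n i)

lemma exists_norm_dispFun_le (m n : Occ M) : ∃ K : ℝ, ∀ l, ‖dispFun m n l‖ ≤ K := by
  choose K hK using fun i => exists_norm_dispElem_le (m i) (n i)
  refine ⟨∏ i, |K i|, fun l => ?_⟩
  rw [dispFun, dispMat, norm_prod]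
  refine Finset.prod_le_prod (fun _ _ => norm_nonneg _) fun i _ => (hK i (l i)).trans ?_
  calc K i * Real.exp (-‖l i‖ ^ 2 / 4) ≤ |K i| * 1 := by
        refine mul_le_mul (le_abs_self _) ?_ (Real.exp_nonneg _) (abs_nonneg _)
        rw [Real.exp_le_one_iff]
        have := sq_nonneg ‖l i‖
        linarith
    _ = |K i| := mul_one _

lemma memLp_dispFun (m n : Occ M) : MemLp (dispFun m n) 2 := by
  have hc := (differentiable_dispFun m n).continuous.aestronglyMeasurable (μ := volume)
  rw [memLp_two_iff_integrable_sq_norm hc]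
  obtain ⟨K, hK⟩ := exists_norm_dispFun_le m n
  have h := (integrable_dispFun m n).norm.mul_bdd (c := K) hc.norm (ae_of_all _ fun l => by
    rw [norm_norm]; exact hK l)
  exact h.congr (ae_of_all _ fun l => (sq _).symm)

/-- The linear span of the matrix elements; it is stable under multiplication by the coordinates
and under Wirtinger derivatives, by the ladder relations. -/
def dispSpan (M : Fin C → Type*) [∀ j, Fintype (M j)] : Submodule ℂ (Amp M → ℂ) :=
  Submodule.span ℂ (Set.range fun p : Occ M × Occ M => dispFun p.1 p.2)

lemma dispFun_mem_dispSpan (m n : Occ M) : dispFun m n ∈ dispSpan M :=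
  Submodule.subset_span ⟨(m, n), rfl⟩

lemma integrable_of_mem_dispSpan {f : Amp M → ℂ} (hf : f ∈ dispSpan M) : Integrable f := by
  induction hf using Submodule.span_induction with
  | mem x h => obtain ⟨p, rfl⟩ := h; exact integrable_dispFun _ _
  | zero => exact integrable_zero _ _ _
  | add x y _ _ hx hy => exact hx.add hy
  | smul a x _ hx => exact hx.smul a

lemma memLp_of_mem_dispSpan {f : Amp M → ℂ} (hf : f ∈ dispSpan M) : MemLp f 2 := by
  induction hf using Submodule.span_induction with
  | mem x h => obtain ⟨p, rfl⟩ := h; exact memLp_dispFun _ _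
  | zero => exact MemLp.zero
  | add x y _ _ hx hy => exact hx.add hy
  | smul a x _ hx => exact hx.const_smul a

lemma integrable_conj_mul_of_mem_dispSpan {f g : Amp M → ℂ} (hf : f ∈ dispSpan M)
    (hg : g ∈ dispSpan M) : Integrable fun l => conj (f l) * g l :=
  MemLp.integrable_mul (p := 2) (q := 2) (memLp_of_mem_dispSpan hf).star (memLp_of_mem_dispSpan hg)

lemma coord_mul_dispFun (p : Mode M) (m n : Occ M) (l : Amp M) :
    l p * dispFun m n l = (Real.sqrt (m p + 1 : ℝ) : ℂ) * dispFun (m + Pi.single p 1) n l -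
      (Real.sqrt (n p) : ℂ) * dispFun m (n - Pi.single p 1) l := by
  have := annihilate_dispMat p m n l (fun i => conj (l i))
  simp only [dispFun]
  linear_combination (-1 : ℂ) * this

lemma conj_coord_mul_dispFun (p : Mode M) (m n : Occ M) (l : Amp M) :
    conj (l p) * dispFun m n l = (Real.sqrt (m p) : ℂ) * dispFun (m - Pi.single p 1) n l -
      (Real.sqrt (n p + 1 : ℝ) : ℂ) * dispFun m (n + Pi.single p 1) l := by
  have := create_dispMat p m n l (fun i => conj (l i))
  simp only [dispFun]
  linear_combination (-1 : ℂ) * this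

lemma coord_mul_mem_dispSpan (p : Mode M) {f : Amp M → ℂ} (hf : f ∈ dispSpan M) :
    (fun l => l p * f l) ∈ dispSpan M := by
  induction hf using Submodule.span_induction with
  | mem x h =>
    obtain ⟨⟨m, n⟩, rfl⟩ := h
    rw [funext (coord_mul_dispFun p m n)]
    exact sub_mem (Submodule.smul_mem _ _ (dispFun_mem_dispSpan _ _))
      (Submodule.smul_mem _ _ (dispFun_mem_dispSpan _ _))
  | zero =>
    simp only [Pi.zero_apply, mul_zero]
    exact (dispSpan M).zero_mem
  | add x y _ _ hx hy =>
    simp only [Pi.add_apply, mul_add]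
    exact add_mem hx hy
  | smul a x _ hx =>
    convert! Submodule.smul_mem _ a hx using 1
    funext l
    simp only [Pi.smul_apply, smul_eq_mul]; ring

lemma conj_coord_mul_mem_dispSpan (p : Mode M) {f : Amp M → ℂ} (hf : f ∈ dispSpan M) :
    (fun l => conj (l p) * f l) ∈ dispSpan M := by
  induction hf using Submodule.span_induction with
  | mem x h =>
    obtain ⟨⟨m, n⟩, rfl⟩ := h
    rw [funext (conj_coord_mul_dispFun p m n)]
    exact sub_mem (Submodule.smul_mem _ _ (dispFun_mem_dispSpan _ _))
      (Submodule.smul_mem _ _ (dispFun_mem_dispSpan _ _))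
  | zero =>
    simp only [Pi.zero_apply, mul_zero]
    exact (dispSpan M).zero_mem
  | add x y _ _ hx hy =>
    simp only [Pi.add_apply, mul_add]
    exact add_mem hx hy
  | smul a x _ hx =>
    convert! Submodule.smul_mem _ a hx using 1
    funext l
    simp only [Pi.smul_apply, smul_eq_mul]; ring

lemma lineDeriv_dispFun (m n : Occ M) (l v : Amp M) :
    lineDeriv ℝ (dispFun m n) l v =
      ∑ p, (((Real.sqrt (m p) : ℂ) * dispFun (m - Pi.single p 1) n l
          - conj (l p) / 2 * dispFun m n l) * v p
        + (-((Real.sqrt (n p) : ℂ) * dispFun m (n - Pi.single p 1) l)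
          - l p / 2 * dispFun m n l) * conj (v p)) := by
  have hx : ∀ i, HasDerivAt (fun t : ℝ => (l + t • v) i) (v i) 0 := fun i => by
    have h : HasDerivAt (fun t : ℝ => l i + t • v i) ((1 : ℝ) • v i) 0 :=
      ((hasDerivAt_id (0 : ℝ)).smul_const (v i)).const_add (l i)
    simpa using h
  have hy : ∀ i, HasDerivAt (fun t : ℝ => conj ((l + t • v) i)) (conj (v i)) 0 := fun i =>
    Complex.conjCLE.toContinuousLinearMap.hasFDerivAt.comp_hasDerivAt (0 : ℝ) (hx i)
  have h := hasDerivAt_dispMat (𝕜 := ℝ) m n (x := fun t => l + t • v)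
    (y := fun t i => conj ((l + t • v) i)) (x' := v) (y' := fun i => conj (v i)) hx hy
  rw [lineDeriv]
  refine Eq.trans h.deriv ?_
  simp only [zero_smul, add_zero, dispFun]

lemma wirtinger_dispFun (p : Mode M) (m n : Occ M) (l : Amp M) :
    wirtinger p (dispFun m n) l = (Real.sqrt (m p) : ℂ) * dispFun (m - Pi.single p 1) n l
      - conj (l p) / 2 * dispFun m n l := by
  rw [wirtinger, lineDeriv_dispFun, lineDeriv_dispFun,
    Finset.sum_eq_single p (by intro q _ hq; simp [hq]) (by simp),
    Finset.sum_eq_single p (by intro q _ hq; simp [hq]) (by simp)]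
  simp only [Pi.single_eq_same, map_one, Complex.conj_I]
  linear_combination (-(((Real.sqrt (m p) : ℂ) * dispFun (m - Pi.single p 1) n l
      - conj (l p) / 2 * dispFun m n l) + ((Real.sqrt (n p) : ℂ) * dispFun m (n - Pi.single p 1) l
      + l p / 2 * dispFun m n l)) / 2) * Complex.I_mul_I

lemma wirtingerConj_dispFun (p : Mode M) (m n : Occ M) (l : Amp M) :
    wirtingerConj p (dispFun m n) l = -((Real.sqrt (n p) : ℂ) * dispFun m (n - Pi.single p 1) l)
      - l p / 2 * dispFun m n l := by
  rw [wirtingerConj, lineDeriv_dispFun, lineDeriv_dispFun,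
    Finset.sum_eq_single p (by intro q _ hq; simp [hq]) (by simp),
    Finset.sum_eq_single p (by intro q _ hq; simp [hq]) (by simp)]
  simp only [Pi.single_eq_same, map_one, Complex.conj_I]
  linear_combination ((((Real.sqrt (m p) : ℂ) * dispFun (m - Pi.single p 1) n l
      - conj (l p) / 2 * dispFun m n l) + ((Real.sqrt (n p) : ℂ) * dispFun m (n - Pi.single p 1) l
      + l p / 2 * dispFun m n l)) / 2) * Complex.I_mul_I

lemma wirtinger_dispFun_mem (p : Mode M) (m n : Occ M) :
    wirtinger p (dispFun m n) ∈ dispSpan M := by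
  have h := sub_mem (Submodule.smul_mem _ (Real.sqrt (m p) : ℂ)
    (dispFun_mem_dispSpan (m - Pi.single p 1) n))
    (Submodule.smul_mem _ (1 / 2 : ℂ) (conj_coord_mul_mem_dispSpan p (dispFun_mem_dispSpan m n)))
  convert! h using 1
  funext l
  rw [wirtinger_dispFun]
  simp only [Pi.sub_apply, Pi.smul_apply, smul_eq_mul]; ring

lemma wirtingerConj_dispFun_mem (p : Mode M) (m n : Occ M) :
    wirtingerConj p (dispFun m n) ∈ dispSpan M := by
  have h := sub_mem (Submodule.smul_mem _ (-Real.sqrt (n p) : ℂ)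
    (dispFun_mem_dispSpan m (n - Pi.single p 1)))
    (Submodule.smul_mem _ (1 / 2 : ℂ) (coord_mul_mem_dispSpan p (dispFun_mem_dispSpan m n)))
  convert! h using 1
  funext l
  rw [wirtingerConj_dispFun]
  simp only [Pi.sub_apply, Pi.smul_apply, smul_eq_mul]; ring

/-- The overlap of two matrix elements in `L²`. -/
noncomputable def dispGram (m n m' n' : Occ M) : ℂ :=
  ∫ l : Amp M, conj (dispFun m n l) * dispFun m' n' l

lemma dispGram_conj (m n m' n' : Occ M) : conj (dispGram m n m' n') = dispGram m' n' m n := by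
  rw [dispGram, dispGram, ← integral_conj]
  congr 1
  funext l
  simp [mul_comm]

lemma integral_conj_dispFun_wirtinger (p : Mode M) (m n m' n' : Occ M) :
    (∫ l, conj (dispFun m n l) * wirtinger p (dispFun m' n') l =
      -∫ l, conj (wirtingerConj p (dispFun m n) l) * dispFun m' n' l) ∧
    (∫ l, conj (dispFun m n l) * wirtingerConj p (dispFun m' n') l =
      -∫ l, conj (wirtinger p (dispFun m n) l) * dispFun m' n' l) := by
  have hd := differentiable_dispFun m n
  have hs : ∀ l, wirtinger p (fun l => conj (dispFun m n l)) l =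
    conj (wirtingerConj p (dispFun m n) l) := fun l => wirtinger_conj (hd l) p
  have hs' : ∀ l, wirtingerConj p (fun l => conj (dispFun m n l)) l =
    conj (wirtinger p (dispFun m n) l) := fun l => wirtingerConj_conj (hd l) p
  have h := integral_mul_wirtinger_and_conj (f := fun l => conj (dispFun m n l))
    (g := dispFun m' n') (Complex.conjCLE.differentiable.comp hd)
    (differentiable_dispFun m' n')
    (integrable_conj_mul_of_mem_dispSpan (dispFun_mem_dispSpan _ _) (dispFun_mem_dispSpan _ _)) p
    (by simp only [hs]; exact integrable_conj_mul_of_mem_dispSpan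
          (wirtingerConj_dispFun_mem _ _ _) (dispFun_mem_dispSpan _ _))
    (by simp only [hs']; exact integrable_conj_mul_of_mem_dispSpan
          (wirtinger_dispFun_mem _ _ _) (dispFun_mem_dispSpan _ _))
    (integrable_conj_mul_of_mem_dispSpan (dispFun_mem_dispSpan _ _) (wirtinger_dispFun_mem _ _ _))
    (integrable_conj_mul_of_mem_dispSpan (dispFun_mem_dispSpan _ _)
      (wirtingerConj_dispFun_mem _ _ _))
  simpa only [hs, hs'] using h

lemma dispGram_ladder_left (p : Mode M) (m n m' n' : Occ M) :
    (Real.sqrt (m p + 1 : ℝ) : ℂ) * dispGram (m + Pi.single p 1) n m' n' =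
      (Real.sqrt (m' p) : ℂ) * dispGram m n (m' - Pi.single p 1) n' := by
  have h := (integral_conj_dispFun_wirtinger p m n m' n').1
  have i1 := integrable_conj_mul_of_mem_dispSpan (dispFun_mem_dispSpan m n)
    (wirtinger_dispFun_mem p m' n')
  have i2 := integrable_conj_mul_of_mem_dispSpan (wirtingerConj_dispFun_mem p m n)
    (dispFun_mem_dispSpan m' n')
  rw [eq_neg_iff_add_eq_zero, ← integral_add i1 i2] at h
  have j1 := (integrable_conj_mul_of_mem_dispSpan (dispFun_mem_dispSpan m n)
    (dispFun_mem_dispSpan (m' - Pi.single p 1) n')).const_mul (Real.sqrt (m' p) : ℂ)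
  have j2 := (integrable_conj_mul_of_mem_dispSpan (dispFun_mem_dispSpan (m + Pi.single p 1) n)
    (dispFun_mem_dispSpan m' n')).const_mul (Real.sqrt (m p + 1 : ℝ) : ℂ)
  rw [dispGram, dispGram, ← integral_const_mul, ← integral_const_mul, eq_comm, ← sub_eq_zero,
    ← integral_sub j1 j2, ← h]
  congr 1
  funext l
  have e := congrArg (starRingEnd ℂ) (coord_mul_dispFun p m n l)
  rw [wirtinger_dispFun, wirtingerConj_dispFun]
  simp only [map_sub, map_mul, map_neg, map_div₀, map_ofNat, Complex.conj_ofReal] at e ⊢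
  linear_combination dispFun m' n' l * e

lemma dispGram_ladder_right (p : Mode M) (m n m' n' : Occ M) :
    (Real.sqrt (n p + 1 : ℝ) : ℂ) * dispGram m (n + Pi.single p 1) m' n' =
      (Real.sqrt (n' p) : ℂ) * dispGram m n m' (n' - Pi.single p 1) := by
  have h := (integral_conj_dispFun_wirtinger p m n m' n').2
  have i1 := integrable_conj_mul_of_mem_dispSpan (dispFun_mem_dispSpan m n)
    (wirtingerConj_dispFun_mem p m' n')
  have i2 := integrable_conj_mul_of_mem_dispSpan (wirtinger_dispFun_mem p m n)
    (dispFun_mem_dispSpan m' n')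
  rw [eq_neg_iff_add_eq_zero, ← integral_add i1 i2] at h
  have j1 := (integrable_conj_mul_of_mem_dispSpan (dispFun_mem_dispSpan m n)
    (dispFun_mem_dispSpan m' (n' - Pi.single p 1))).const_mul (Real.sqrt (n' p) : ℂ)
  have j2 := (integrable_conj_mul_of_mem_dispSpan (dispFun_mem_dispSpan m (n + Pi.single p 1))
    (dispFun_mem_dispSpan m' n')).const_mul (Real.sqrt (n p + 1 : ℝ) : ℂ)
  rw [dispGram, dispGram, ← integral_const_mul, ← integral_const_mul, ← sub_eq_zero,
    ← integral_sub j2 j1, ← h]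
  congr 1
  funext l
  have e := congrArg (starRingEnd ℂ) (conj_coord_mul_dispFun p m n l)
  rw [wirtinger_dispFun, wirtingerConj_dispFun]
  simp only [map_sub, map_mul, map_div₀, map_ofNat, Complex.conj_ofReal, Complex.conj_conj] at e ⊢
  linear_combination dispFun m' n' l * e

/-- A matrix `K` over the occupation numbers that intertwines the ladder operators is a multiple
of the identity. -/
lemma eq_ite_of_ladder {K : Occ M → Occ M → ℂ}
    (h : ∀ p m m', (Real.sqrt (m p + 1 : ℝ) : ℂ) * K (m + Pi.single p 1) m' =
      (Real.sqrt (m' p) : ℂ) * K m (m' - Pi.single p 1))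
    (h0 : ∀ m', m' ≠ 0 → K 0 m' = 0) (m m' : Occ M) :
    K m m' = if m = m' then K 0 0 else 0 := by
  obtain ⟨k, hk⟩ : ∃ k, ∑ i, m i = k := ⟨_, rfl⟩
  induction k generalizing m m' with
  | zero =>
    have hm : m = 0 := by
      funext i
      exact Finset.sum_eq_zero_iff.1 hk i (Finset.mem_univ i)
    subst hm
    split_ifs with e
    · rw [← e]
    · exact h0 m' fun h => e h.symm
  | succ k ih =>
    obtain ⟨p, _, hp⟩ := Finset.exists_ne_zero_of_sum_ne_zero (hk.trans_ne (Nat.succ_ne_zero k))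
    have hms : m - Pi.single p 1 + Pi.single p 1 = m := by
      funext i
      by_cases hi : i = p
      · subst hi; simp; omega
      · simp [hi]
    have hsum : ∑ i, (m - Pi.single p 1 : Occ M) i = k := by
      have := congrArg (fun m : Occ M => ∑ i, m i) hms
      simp only [Pi.add_apply, Finset.sum_add_distrib, Finset.sum_pi_single', Finset.mem_univ,
        if_true] at this
      omega
    have e := h p (m - Pi.single p 1) m'
    rw [hms, ih _ _ hsum] at e
    have hmp : ((m - Pi.single p 1 : Occ M) p : ℝ) + 1 = m p := by
      have : (m - Pi.single p 1 : Occ M) p + 1 = m p := congrFun hms p |>.symm ▸ by simp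
      exact_mod_cast this
    rw [hmp] at e
    have hne : (Real.sqrt (m p) : ℂ) ≠ 0 := by
      have : 0 < (m p : ℝ) := by exact_mod_cast Nat.pos_of_ne_zero hp
      exact_mod_cast (Real.sqrt_pos.2 this).ne'
    refine mul_left_cancel₀ hne (e.trans ?_)
    by_cases hmm : m = m'
    · subst hmm; simp
    rw [if_neg hmm, mul_zero]
    by_cases hp' : m' p = 0
    · simp [hp']
    rw [if_neg, mul_zero]
    intro e'
    apply hmm
    funext i
    have := congrFun e' i
    by_cases hi : i = p
    · subst hi; simp at this; omega
    · simpa [hi] using this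

/-- The matrix elements of the displacement operators are orthogonal in `L²` and of equal norm. -/
lemma dispGram_eq (m n m' n' : Occ M) :
    dispGram m n m' n' = if (m, n) = (m', n') then dispGram 0 0 0 (0 : Occ M) else 0 := by
  have hL : ∀ p (m n m' n' : Occ M), m p = 0 → m' p ≠ 0 → dispGram m n m' n' = 0 := by
    intro p m n m' n' h h'
    have hms : m' - Pi.single p 1 + Pi.single p 1 = m' := by
      funext i
      by_cases hi : i = p
      · subst hi; simp; omega
      · simp [hi]
    have e := dispGram_ladder_left p (m' - Pi.single p 1) n' m n
    rw [hms, h] at e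
    have hne : (Real.sqrt ((m' - Pi.single p 1 : Occ M) p + 1 : ℝ) : ℂ) ≠ 0 := by
      exact_mod_cast (Real.sqrt_pos.2 (by positivity)).ne'
    have e2 : dispGram m' n' m n = 0 := by
      rw [Nat.cast_zero, Real.sqrt_zero, Complex.ofReal_zero, zero_mul] at e
      exact (mul_eq_zero.1 e).resolve_left hne
    rw [← dispGram_conj, e2, map_zero]
  have hR : ∀ p (m n m' n' : Occ M), n p = 0 → n' p ≠ 0 → dispGram m n m' n' = 0 := by
    intro p m n m' n' h h'
    have hms : n' - Pi.single p 1 + Pi.single p 1 = n' := by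
      funext i
      by_cases hi : i = p
      · subst hi; simp; omega
      · simp [hi]
    have e := dispGram_ladder_right p m' (n' - Pi.single p 1) m n
    rw [hms, h] at e
    have hne : (Real.sqrt ((n' - Pi.single p 1 : Occ M) p + 1 : ℝ) : ℂ) ≠ 0 := by
      exact_mod_cast (Real.sqrt_pos.2 (by positivity)).ne'
    have e2 : dispGram m' n' m n = 0 := by
      rw [Nat.cast_zero, Real.sqrt_zero, Complex.ofReal_zero, zero_mul] at e
      exact (mul_eq_zero.1 e).resolve_left hne
    rw [← dispGram_conj, e2, map_zero]
  have h1 := eq_ite_of_ladder (K := fun m m' => dispGram m n m' n')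
    (fun p m m' => dispGram_ladder_left p m n m' n')
    (fun m' hm' => by
      obtain ⟨p, hp⟩ := Function.ne_iff.1 hm'
      exact hL p _ _ _ _ rfl hp) m m'
  have h2 := eq_ite_of_ladder (K := fun n n' => dispGram (0 : Occ M) n 0 n')
    (fun p n n' => dispGram_ladder_right p 0 n 0 n')
    (fun n' hn' => by
      obtain ⟨p, hp⟩ := Function.ne_iff.1 hn'
      exact hR p _ _ _ _ rfl hp) n n'
  rw [h1, h2]
  by_cases hm : m = m' <;> by_cases hn : n = n' <;> simp [hm, hn]

end Modes

/-! ### The characteristic functional of a Hilbert-Schmidt operator -/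

lemma tendsto_eLpNorm_sub {X ι : Type*} [MeasurableSpace X] {μ : Measure X} {u : Filter ι}
    {F : ι → Lp ℂ 2 μ} {V : Lp ℂ 2 μ} (h : Tendsto F u (𝓝 V)) {f : ι → X → ℂ} {g : X → ℂ}
    (hf : ∀ i, F i =ᵐ[μ] f i) (hg : V =ᵐ[μ] g) :
    Tendsto (fun i => eLpNorm (fun x => g x - f i x) 2 μ) u (𝓝 0) := by
  have h1 := tendsto_iff_edist_tendsto_0.1 h
  refine h1.congr fun i => ?_
  rw [edist_comm, Lp.edist_def]
  refine eLpNorm_congr_ae ?_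
  filter_upwards [hf i, hg] with x h1 h2
  simp [h1, h2]

lemma ae_eq_of_tendsto_eLpNorm_sub {X ι : Type*} [MeasurableSpace X] {μ : Measure X}
    {u : Filter ι} [u.NeBot] {f : ι → X → ℂ} {g g' : X → ℂ}
    (hf : ∀ i, AEStronglyMeasurable (f i) μ) (hg : AEStronglyMeasurable g μ)
    (hg' : AEStronglyMeasurable g' μ)
    (h : Tendsto (fun i => eLpNorm (fun x => g x - f i x) 2 μ) u (𝓝 0))
    (h' : Tendsto (fun i => eLpNorm (fun x => g' x - f i x) 2 μ) u (𝓝 0)) : g =ᵐ[μ] g' := by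
  have hle : ∀ i, eLpNorm (fun x => g x - g' x) 2 μ ≤
      eLpNorm (fun x => g x - f i x) 2 μ + eLpNorm (fun x => g' x - f i x) 2 μ := fun i => by
    have := eLpNorm_sub_le (p := 2) (hg.sub (hf i)) (hg'.sub (hf i)) (by norm_num)
    refine le_of_eq_of_le (congrArg (fun φ => eLpNorm φ 2 μ) ?_) this
    funext x
    simp
  have h0 : eLpNorm (fun x => g x - g' x) 2 μ = 0 := by
    refine le_antisymm (ge_of_tendsto' (by simpa using h.add h') hle) zero_le
  have h0 := (eLpNorm_eq_zero_iff (hg.sub hg') (by norm_num)).1 h0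
  filter_upwards [h0] with x hx
  exact sub_eq_zero.1 hx

/-- A series that converges both in `L²` and pointwise has the same sum in both senses. -/
lemma ae_eq_of_hasSum_of_forall_hasSum {X ι : Type*} [Countable ι] [MeasurableSpace X]
    {μ : Measure X} {F : ι → Lp ℂ 2 μ} {V : Lp ℂ 2 μ} (h : HasSum F V) {f : ι → X → ℂ} {g : X → ℂ}
    (hf : ∀ i, F i =ᵐ[μ] f i) (hg : ∀ x, HasSum (fun i => f i x) (g x)) : V =ᵐ[μ] g := by
  have h1 := tendsto_iff_edist_tendsto_0.1 h
  have h2 : TendstoInMeasure μ (fun s : Finset ι => ((∑ i ∈ s, F i : Lp ℂ 2 μ) : X → ℂ)) atTop V := by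
    refine tendstoInMeasure_of_tendsto_eLpNorm (p := 2) (by norm_num)
      (fun s => Lp.aestronglyMeasurable _) (Lp.aestronglyMeasurable _) ?_
    simpa only [Lp.edist_def] using! h1
  obtain ⟨ns, hns, hae⟩ := h2.exists_seq_tendsto_ae'
  filter_upwards [hae, ae_all_iff.2 fun s : Finset ι => Lp.coeFn_finsetSum s F, ae_all_iff.2 hf]
    with x hx hs hfx
  refine tendsto_nhds_unique hx ?_
  have := (hg x).comp hns
  refine this.congr fun k => ?_
  simp only [Function.comp_apply, hs, Finset.sum_apply, hfx]

section Modes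

variable {D C : ℕ} {M : Fin C → Type*} [∀ j, Fintype (M j)] [∀ j, DecidableEq (M j)]

/-- Square-summable matrices over the occupation numbers. -/
noncomputable abbrev OccMatrix (M : Fin C → Type*) := lp (fun _ : Occ M × Occ M => ℂ) 2

/-- The matrix element `⟨m| D(λ) |n⟩` as an element of `L²`. -/
noncomputable def dispLp (m n : Occ M) : Lp ℂ 2 (volume : Measure (Amp M)) :=
  (memLp_dispFun m n).toLp (dispFun m n)

lemma coeFn_dispLp (m n : Occ M) : dispLp m n =ᵐ[volume] dispFun m n :=
  (memLp_dispFun m n).coeFn_toLp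

lemma inner_dispLp (m n m' n' : Occ M) :
    inner ℂ (dispLp m n) (dispLp m' n') = dispGram m n m' n' := by
  rw [L2.inner_def, dispGram]
  refine integral_congr_ae ?_
  filter_upwards [coeFn_dispLp m n, coeFn_dispLp m' n'] with l h1 h2
  rw [h1, h2, RCLike.inner_apply, mul_comm]

variable (M) in
/-- The common `L²` norm of the matrix elements of the displacement operators. -/
noncomputable def dispNorm : ℝ := ‖(dispLp 0 0 : Lp ℂ 2 (volume : Measure (Amp M)))‖

lemma dispNorm_ne_zero : dispNorm M ≠ 0 := by
  rw [dispNorm, norm_ne_zero_iff]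
  intro h
  have h1 : dispFun (0 : Occ M) 0 =ᵐ[volume] 0 :=
    (coeFn_dispLp (0 : Occ M) 0).symm.trans (h ▸ Lp.coeFn_zero ℂ 2 volume)
  have h2 := ((differentiable_dispFun (0 : Occ M) 0).continuous.ae_eq_iff_eq volume
    continuous_zero).1 h1
  have h3 : dispFun (0 : Occ M) 0 0 = 1 := by
    have : (fun i : Mode M => conj ((0 : Amp M) i)) = 0 := by funext i; simp
    rw [dispFun, this, dispMat_zero, if_pos rfl]
  rw [h2] at h3
  exact zero_ne_one h3

lemma orthonormal_dispLp :
    Orthonormal ℂ fun p : Occ M × Occ M => ((dispNorm M : ℂ))⁻¹ • dispLp p.2 p.1 := by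
  classical
  rw [orthonormal_iff_ite]
  intro p q
  have hc : (dispNorm M : ℂ) ≠ 0 := by exact_mod_cast dispNorm_ne_zero
  have h0 : dispGram 0 0 0 (0 : Occ M) = (dispNorm M : ℂ) ^ 2 := by
    rw [← inner_dispLp, inner_self_eq_norm_sq_to_K]
    rfl
  rw [inner_smul_left, inner_smul_right, inner_dispLp, dispGram_eq, h0]
  have : ((p.2, p.1) = (q.2, q.1)) ↔ p = q := by
    rw [Prod.mk.injEq, and_comm, Prod.ext_iff]
  simp only [this, map_inv₀, Complex.conj_ofReal]
  split_ifs
  · field_simp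
  · simp

/-- The isometry that takes a matrix `(c_{nm})` to the normalized sum `∑ c_{nm} ⟨m| D(λ) |n⟩`. -/
noncomputable def dispIso : OccMatrix M →ₗᵢ[ℂ] Lp ℂ 2 (volume : Measure (Amp M)) :=
  (orthonormal_dispLp (M := M)).orthogonalFamily.linearIsometry

variable (M) in
/-- The map that takes the matrix `(A_{nm})` to the characteristic functional
`Tr {A D(λ)} = ∑ A_{nm} ⟨m| D(λ) |n⟩`. -/
noncomputable def charMap : OccMatrix M →L[ℂ] Lp ℂ 2 (volume : Measure (Amp M)) :=
  (dispNorm M : ℂ) • (dispIso (M := M)).toContinuousLinearMap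

lemma hasSum_charMap (a : OccMatrix M) :
    HasSum (fun p : Occ M × Occ M => a p • dispLp p.2 p.1) (charMap M a) := by
  have h := ((orthonormal_dispLp (M := M)).orthogonalFamily.hasSum_linearIsometry a).const_smul
    (dispNorm M : ℂ)
  refine HasSum.congr_fun (f := fun p : Occ M × Occ M => (dispNorm M : ℂ) •
    LinearIsometry.toSpanSingleton ℂ _ (orthonormal_dispLp.1 p) (a p)) h fun p => ?_
  have hc : (dispNorm M : ℂ) ≠ 0 := by exact_mod_cast dispNorm_ne_zero
  rw [LinearIsometry.toSpanSingleton_apply, smul_comm, smul_inv_smul₀ hc]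

lemma IsHilbertSchmidt.memℓp {A : Fock M →L[ℂ] Fock M} (hA : IsHilbertSchmidt A) :
    Memℓp (fun p : Occ M × Occ M => A (numberState p.2) p.1) 2 := by
  refine memℓp_gen ?_
  simp only [ENNReal.toReal_ofNat, Real.rpow_two]
  have hcol : ∀ v : Fock M, HasSum (fun n => ‖v n‖ ^ 2) (‖v‖ ^ 2) := fun v => by
    have := lp.hasSum_norm (p := 2) (by norm_num) v
    simpa only [ENNReal.toReal_ofNat, Real.rpow_two] using this
  have h : Summable fun p : Occ M × Occ M => ‖A (numberState p.1) p.2‖ ^ 2 := by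
    refine (summable_prod_of_nonneg (fun p => sq_nonneg _)).2 ?_
    refine ⟨fun m => (hcol (A (numberState m))).summable, ?_⟩
    exact Summable.congr hA fun m => (hcol (A (numberState m))).tsum_eq.symm
  exact h.prod_symm

/-- The matrix `(A_{nm})` of a Hilbert-Schmidt operator. -/
noncomputable def hsMatrix {A : Fock M →L[ℂ] Fock M} (hA : IsHilbertSchmidt A) : OccMatrix M :=
  ⟨_, hA.memℓp⟩

lemma hsMatrix_apply {A : Fock M →L[ℂ] Fock M} (hA : IsHilbertSchmidt A) (n m : Occ M) :
    hsMatrix hA (n, m) = A (numberState m) n := rfl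

lemma inner_numberState (n : Occ M) (v : Fock M) : inner ℂ (numberState n) v = v n := by
  classical
  rw [numberState, lp.inner_single_left, RCLike.inner_apply, map_one, mul_one]

/-- The partial sums of the trace over the number states converge to `charMap` in `L²`. -/
lemma tendsto_trace {A : Fock M →L[ℂ] Fock M} (hA : IsHilbertSchmidt A) :
    Tendsto (fun s : Finset (Occ M) => eLpNorm (fun l : Amp M => charMap M (hsMatrix hA) l -
      ∑ n ∈ s, inner ℂ (numberState n) ((A * dispOp l) (numberState n))) 2 volume) atTop (𝓝 0) := by
  have h := hasSum_charMap (hsMatrix hA)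
  have hfib : ∀ n, HasSum (fun m => hsMatrix hA (n, m) • dispLp m n)
      (∑' m, hsMatrix hA (n, m) • dispLp m n) := fun n =>
    (h.summable.prod_factor n).hasSum
  have h2 := h.prod_fiberwise hfib
  have hpt : ∀ n, (∑' m, hsMatrix hA (n, m) • dispLp m n : Lp ℂ 2 (volume : Measure (Amp M)))
      =ᵐ[volume] fun l => inner ℂ (numberState n) ((A * dispOp l) (numberState n)) := fun n => by
    refine ae_eq_of_hasSum_of_forall_hasSum (hfib n)
      (f := fun m l => hsMatrix hA (n, m) * dispFun m n l) (fun m => ?_) fun l => ?_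
    · filter_upwards [Lp.coeFn_smul (hsMatrix hA (n, m)) (dispLp m n), coeFn_dispLp m n]
        with l h1 h2
      rw [h1, Pi.smul_apply, h2, smul_eq_mul]
    · rw [inner_numberState, mul_apply_eq_comp, dispOp_numberState]
      refine (hasSum_apply_numberState A (dispCol l n) n).congr_fun fun m => ?_
      rw [hsMatrix_apply, mul_comm]
      rfl
  refine tendsto_eLpNorm_sub h2 (fun s => ?_) (ae_eq_refl _)
  filter_upwards [Lp.coeFn_finsetSum s
    (fun n => ∑' m, hsMatrix hA (n, m) • dispLp m n),
    ae_all_iff.2 hpt] with l h1 h2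
  rw [h1, Finset.sum_apply]
  exact Finset.sum_congr rfl fun n _ => h2 n

namespace RestrictedBasis

lemma isCharacteristic_charMap (b : RestrictedBasis D M) {A : Fock M →L[ℂ] Fock M}
    (hA : IsHilbertSchmidt A) : b.IsCharacteristic A (charMap M (hsMatrix hA)) := by
  refine ⟨_, b.isDisplacement_dispOp, Lp.memLp _, ?_⟩
  simp only [prod_ofFn_dispOp]
  exact tendsto_trace hA

lemma aestronglyMeasurable_trace (A : Fock M →L[ℂ] Fock M) (n : Occ M) :
    AEStronglyMeasurable (fun l : Amp M =>
      inner ℂ (numberState n) ((A * dispOp l) (numberState n))) volume := by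
  have h : ∀ l : Amp M, HasSum (fun m => dispFun m n l * A (numberState m) n)
      (inner ℂ (numberState n) ((A * dispOp l) (numberState n))) := fun l => by
    rw [inner_numberState, mul_apply_eq_comp, dispOp_numberState]
    exact hasSum_apply_numberState A (dispCol l n) n
  refine aestronglyMeasurable_of_tendsto_ae atTop
    (f := fun (s : Finset (Occ M)) l => ∑ m ∈ s, dispFun m n l * A (numberState m) n)
    (fun s => ?_) (ae_of_all _ fun l => h l)
  refine (continuous_finsetSum _ fun m _ => ?_).aestronglyMeasurable
  exact (differentiable_dispFun m n).continuous.mul continuous_const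

lemma IsCharacteristic.ae_eq {b : RestrictedBasis D M} {A : Fock M →L[ℂ] Fock M}
    (hA : IsHilbertSchmidt A) {χ : Amp M → ℂ} (h : b.IsCharacteristic A χ) :
    χ =ᵐ[volume] charMap M (hsMatrix hA) := by
  obtain ⟨U, hU, hχ, ht⟩ := h
  simp only [hU.prod_eq] at ht
  refine ae_eq_of_tendsto_eLpNorm_sub (fun s => ?_) hχ.1 (Lp.aestronglyMeasurable _) ht
    (tendsto_trace hA)
  exact Finset.aestronglyMeasurable_fun_sum _ fun n _ => aestronglyMeasurable_trace A n

end RestrictedBasis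

end Modes

/-! ### The symplectic Fourier transform on `L²` -/

section Composition

variable {V W : Type*} [NormedAddCommGroup V] [NormedSpace ℝ V] [FiniteDimensional ℝ V]
  [MeasureSpace V] [BorelSpace V] [(volume : Measure V).IsAddHaarMeasure]
  [NormedAddCommGroup W] [NormedSpace ℝ W] [FiniteDimensional ℝ W]
  [MeasureSpace W] [BorelSpace W] [(volume : Measure W).IsAddHaarMeasure]

/-- The factor by which a linear isomorphism changes volumes. -/
noncomputable def volumeFactor (e : V ≃L[ℝ] W) : NNReal :=
  haveI := e.isAddHaarMeasure_map (volume : Measure V)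
  Measure.addHaarScalarFactor (Measure.map e (volume : Measure V)) (volume : Measure W)

lemma map_volume_eq_smul (e : V ≃L[ℝ] W) :
    Measure.map e (volume : Measure V) = (volumeFactor e : ENNReal) • (volume : Measure W) := by
  have := e.isAddHaarMeasure_map (volume : Measure V)
  exact Measure.isAddLeftInvariant_eq_smul _ _

lemma eLpNorm_comp_continuousLinearEquiv (e : V ≃L[ℝ] W) (f : W → ℂ) :
    eLpNorm (f ∘ e) 2 volume = (volumeFactor e : ENNReal) ^ (1 / (2 : ENNReal)).toReal •
      eLpNorm f 2 volume := by
  rw [← eLpNorm_smul_measure_of_ne_top (by norm_num), ← map_volume_eq_smul]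
  exact (e.toHomeomorph.measurableEmbedding.eLpNorm_map_measure).symm

lemma quasiMeasurePreserving_continuousLinearEquiv (e : V ≃L[ℝ] W) :
    Measure.QuasiMeasurePreserving e volume volume :=
  ⟨e.continuous.measurable, by
    rw [map_volume_eq_smul]; exact Measure.smul_absolutelyContinuous⟩

lemma memLp_comp_continuousLinearEquiv (e : V ≃L[ℝ] W) {f : W → ℂ} (hf : MemLp f 2) :
    MemLp (f ∘ e) 2 := by
  refine ⟨hf.1.comp_quasiMeasurePreserving (quasiMeasurePreserving_continuousLinearEquiv e), ?_⟩
  rw [eLpNorm_comp_continuousLinearEquiv, smul_eq_mul]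
  exact ENNReal.mul_lt_top (ENNReal.rpow_lt_top_of_nonneg (by positivity) ENNReal.coe_ne_top) hf.2

/-- Composition with a linear isomorphism, on `L²`. -/
noncomputable def compLp (e : V ≃L[ℝ] W) :
    Lp ℂ 2 (volume : Measure W) →L[ℂ] Lp ℂ 2 (volume : Measure V) :=
  LinearMap.mkContinuous
    { toFun := fun f => (memLp_comp_continuousLinearEquiv e (Lp.memLp f)).toLp _
      map_add' := fun f g => by
        refine Eq.trans (MemLp.toLp_congr _ ((memLp_comp_continuousLinearEquiv e (Lp.memLp f)).add
          (memLp_comp_continuousLinearEquiv e (Lp.memLp g))) ?_) (MemLp.toLp_add _ _)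
        exact (quasiMeasurePreserving_continuousLinearEquiv e).ae_eq_comp (Lp.coeFn_add f g)
      map_smul' := fun a f => by
        refine Eq.trans (MemLp.toLp_congr _ ((memLp_comp_continuousLinearEquiv e
          (Lp.memLp f)).const_smul a) ?_) (MemLp.toLp_const_smul _ _)
        exact (quasiMeasurePreserving_continuousLinearEquiv e).ae_eq_comp (Lp.coeFn_smul a f) }
    ((volumeFactor e : ENNReal) ^ (1 / (2 : ENNReal)).toReal).toReal fun f => by
      simp only [LinearMap.coe_mk, AddHom.coe_mk]
      rw [Lp.norm_toLp, eLpNorm_comp_continuousLinearEquiv, smul_eq_mul, ENNReal.toReal_mul,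
        Lp.norm_def]

lemma coeFn_compLp (e : V ≃L[ℝ] W) (f : Lp ℂ 2 (volume : Measure W)) :
    compLp e f =ᵐ[volume] f ∘ e :=
  (memLp_comp_continuousLinearEquiv e (Lp.memLp f)).coeFn_toLp

lemma integral_eq_volumeFactor_mul (e : V ≃L[ℝ] W) (f : V → ℂ) :
    ∫ v, f v = (volumeFactor e : ℂ) * ∫ w, f (e.symm w) := by
  have h := (e.toHomeomorph.measurableEmbedding).integral_map (μ := volume)
    (fun w => f (e.symm w))
  simp only [ContinuousLinearEquiv.coe_toHomeomorph, ContinuousLinearEquiv.symm_apply_apply] at h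
  rw [← h, map_volume_eq_smul, integral_smul_measure]
  simp

end Composition

open FourierTransform in
/-- On `L¹ ∩ L²` the Fourier transform of `L²` is the Fourier integral. -/
lemma fourier_toLp_ae_eq {V : Type*} [NormedAddCommGroup V] [InnerProductSpace ℝ V]
    [FiniteDimensional ℝ V] [MeasurableSpace V] [BorelSpace V] {f : V → ℂ}
    (hf : Integrable f) (hf2 : MemLp f 2) :
    (𝓕 (hf2.toLp f) : Lp ℂ 2 (volume : Measure V)) =ᵐ[volume] (𝓕 f : V → ℂ) := by
  have hcont : Continuous (𝓕 f : V → ℂ) := VectorFourier.fourierIntegral_continuous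
    Real.continuous_fourierChar continuous_inner hf
  refine ae_eq_of_integral_contDiff_smul_eq
    ((Lp.memLp (𝓕 (hf2.toLp f))).locallyIntegrable (by norm_num)) hcont.locallyIntegrable
    fun g hg hgc => ?_
  have hg' : ContDiff ℝ ∞ (fun v => (g v : ℂ)) := Complex.ofRealCLM.contDiff.comp hg
  have hgc' : HasCompactSupport (fun v => (g v : ℂ)) := hgc.comp_left Complex.ofReal_zero
  -- test both sides against the Schwartz function `g`, as tempered distributions
  set G := hgc'.toSchwartzMap hg' with hG
  have hGv : ∀ v, G v = (g v : ℂ) := fun v => rfl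
  have h := congrArg (fun T => T G) (Lp.fourier_toTemperedDistribution_eq (hf2.toLp f))
  simp only [TemperedDistribution.fourier_apply, Lp.toTemperedDistribution_apply, smul_eq_mul,
    hGv] at h
  simp only [Complex.real_smul]
  rw [← h]
  have h2 := VectorFourier.integral_fourierIntegral_smul_eq_flip (μ := volume) (ν := volume)
    (L := innerₗ V) Real.continuous_fourierChar continuous_inner G.integrable hf
  rw [flip_innerₗ] at h2
  calc _ = ∫ v, (𝓕 G) v * f v := by
        refine integral_congr_ae ?_
        filter_upwards [hf2.coeFn_toLp] with v hv
        rw [hv]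
    _ = _ := h2

section Modes

variable {D C : ℕ} {M : Fin C → Type*} [∀ j, Fintype (M j)] [∀ j, DecidableEq (M j)]

lemma norm_symplKernel (l α : Amp M) : ‖symplKernel l α‖ = 1 := by
  rw [symplKernel, Complex.norm_exp, Complex.re_sum, Finset.sum_eq_zero, Real.exp_zero]
  intro i _
  simp

lemma continuous_symplKernel : Continuous fun p : Amp M × Amp M => symplKernel p.1 p.2 := by
  unfold symplKernel
  fun_prop

/-- The symplectic Fourier integral `∫ δ²Λ exp ∑ i, (-λ_i α_i^* + λ_i^* α_i) f(λ)`. -/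
noncomputable def symplFourier (f : Amp M → ℂ) (α : Amp M) : ℂ := ∫ l, symplKernel l α * f l

lemma integrable_symplKernel_mul {f : Amp M → ℂ} (hf : Integrable f) (α : Amp M) :
    Integrable fun l => symplKernel l α * f l := by
  refine hf.bdd_mul (c := 1) ?_ (ae_of_all _ fun l => (norm_symplKernel l α).le)
  exact (continuous_symplKernel.comp (by fun_prop : Continuous fun l : Amp M => (l, α))).aestronglyMeasurable

variable (M) in
/-- The amplitudes with the Euclidean norm. -/
noncomputable def euclideanAmp : Amp M ≃L[ℝ] EuclideanSpace ℂ (Mode M) :=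
  (PiLp.continuousLinearEquiv 2 ℝ (fun _ : Mode M => ℂ)).symm

variable (M) in
/-- The map `α ↦ i α / π` that turns the symplectic pairing into the real inner product. -/
noncomputable def rotateAmp : Amp M ≃L[ℝ] EuclideanSpace ℂ (Mode M) :=
  (((ContinuousLinearEquiv.smulLeft (Units.mk0 (Complex.I / Real.pi) (by
    simp [Real.pi_ne_zero]) : ℂˣ)) : Amp M ≃L[ℂ] Amp M).restrictScalars ℝ).trans (euclideanAmp M)

lemma symplKernel_eq (x : EuclideanSpace ℂ (Mode M)) (α : Amp M) :
    symplKernel ((euclideanAmp M).symm x) α =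
      Complex.exp ((↑(-2 * Real.pi * inner ℝ x (rotateAmp M α)) * Complex.I)) := by
  have h1 : ∀ i, rotateAmp M α i = Complex.I / Real.pi * α i := fun i => rfl
  have h2 : ∀ i, (euclideanAmp M).symm x i = x i := fun i => rfl
  rw [symplKernel, PiLp.inner_apply]
  congr 1
  simp only [h1, h2, Complex.inner, Finset.mul_sum, Complex.ofReal_sum, Finset.sum_mul]
  refine Finset.sum_congr rfl fun i _ => ?_
  have hpi : (Real.pi : ℂ) ≠ 0 := by exact_mod_cast Real.pi_ne_zero
  apply Complex.ext
  · simp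
  · simp [Complex.div_ofReal_re, Complex.div_ofReal_im]
    field_simp
    ring

open FourierTransform in
variable (M) in
/-- The symplectic Fourier transform on `L²`. -/
noncomputable def symplFourierLp :
    Lp ℂ 2 (volume : Measure (Amp M)) →L[ℂ] Lp ℂ 2 (volume : Measure (Amp M)) :=
  (volumeFactor (euclideanAmp M) : ℂ) • (compLp (rotateAmp M)).comp
    ((Lp.fourierTransformₗᵢ (EuclideanSpace ℂ (Mode M)) ℂ).toLinearIsometry.toContinuousLinearMap.comp
      (compLp (euclideanAmp M).symm))

open FourierTransform in
/-- On `L¹ ∩ L²` the symplectic Fourier transform is the symplectic Fourier integral. -/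
lemma symplFourierLp_ae_eq (f : Lp ℂ 2 (volume : Measure (Amp M))) (hf : Integrable f) :
    symplFourierLp M f =ᵐ[volume] symplFourier f := by
  set g : EuclideanSpace ℂ (Mode M) → ℂ := f ∘ (euclideanAmp M).symm with hg
  have hg1 : Integrable g := by
    have h : Integrable f (Measure.map (euclideanAmp M).symm volume) := by
      rw [map_volume_eq_smul]
      exact hf.smul_measure ENNReal.coe_ne_top
    exact ((euclideanAmp M).symm.toHomeomorph.measurableEmbedding.integrable_map_iff).1 h
  have hg2 : MemLp g 2 := memLp_comp_continuousLinearEquiv (euclideanAmp M).symm (Lp.memLp f)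
  have h1 := fourier_toLp_ae_eq hg1 hg2
  have h2 := (quasiMeasurePreserving_continuousLinearEquiv (rotateAmp M)).ae_eq_comp h1
  have h3 := coeFn_compLp (rotateAmp M) (𝓕 (hg2.toLp g) : Lp ℂ 2 volume)
  have h4 := Lp.coeFn_smul (volumeFactor (euclideanAmp M) : ℂ)
    (compLp (rotateAmp M) (𝓕 (hg2.toLp g) : Lp ℂ 2 volume))
  filter_upwards [h2, h3, h4] with α h2 h3 h4
  refine Eq.trans h4 ?_
  rw [Pi.smul_apply, h3, h2, Function.comp_apply, Real.fourier_eq', symplFourier,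
    integral_eq_volumeFactor_mul (euclideanAmp M), smul_eq_mul]
  congr 2
  funext x
  rw [symplKernel_eq]
  rfl

lemma continuous_symplFourier {f : Amp M → ℂ} (hf : Integrable f) :
    Continuous (symplFourier f) := by
  refine continuous_of_dominated (bound := fun l => ‖f l‖)
    (fun α => (integrable_symplKernel_mul hf α).aestronglyMeasurable)
    (fun α => ae_of_all _ fun l => ?_) hf.norm (ae_of_all _ fun l => ?_)
  · rw [norm_mul, norm_symplKernel, one_mul]
  · exact (continuous_symplKernel.comp
      (by fun_prop : Continuous fun α : Amp M => (l, α))).mul continuous_const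

end Modes

/-! ### Existence and uniqueness of the Wigner transform -/

section Modes

variable {D C : ℕ} {M : Fin C → Type*} [∀ j, Fintype (M j)] [∀ j, DecidableEq (M j)]

/-- The restriction of an `L²` function to a ball. -/
noncomputable def truncLp (f : Lp ℂ 2 (volume : Measure (Amp M))) (R : ℝ) :
    Lp ℂ 2 (volume : Measure (Amp M)) :=
  ((Lp.memLp f).indicator (measurableSet_closedBall (x := (0 : Amp M)) (ε := R))).toLp _

lemma coeFn_truncLp (f : Lp ℂ 2 (volume : Measure (Amp M))) (R : ℝ) :
    truncLp f R =ᵐ[volume] (Metric.closedBall (0 : Amp M) R).indicator f :=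
  MemLp.coeFn_toLp _

lemma integrable_truncLp (f : Lp ℂ 2 (volume : Measure (Amp M))) (R : ℝ) :
    Integrable (truncLp f R) := by
  refine Integrable.congr ?_ (coeFn_truncLp f R).symm
  rw [integrable_indicator_iff measurableSet_closedBall]
  exact ((Lp.memLp f).locallyIntegrable (by norm_num)).integrableOn_isCompact
    (isCompact_closedBall 0 R)

lemma tendsto_truncLp (f : Lp ℂ 2 (volume : Measure (Amp M))) :
    Tendsto (truncLp f) atTop (𝓝 f) := by
  rw [EMetric.tendsto_atTop]
  intro ε hε
  obtain ⟨g, hgc, hg, hgcont, hgm⟩ :=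
    (Lp.memLp f).exists_hasCompactSupport_eLpNorm_sub_le (by norm_num) (ENNReal.half_pos hε.ne').ne'
  obtain ⟨R₀, hR₀⟩ := hgc.isCompact.isBounded.subset_closedBall 0
  by_cases htop : ε = ⊤
  · exact ⟨0, fun R _ => htop ▸ edist_lt_top _ _⟩
  refine ⟨R₀, fun R hR => lt_of_le_of_lt ?_ (ENNReal.half_lt_self hε.ne' htop)⟩
  rw [edist_comm, Lp.edist_def]
  refine le_trans ?_ hg
  -- outside the ball `g` vanishes, so there the truncation error is that of `f - g`
  refine eLpNorm_mono_ae ?_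
  filter_upwards [coeFn_truncLp f R] with l hl
  rw [Pi.sub_apply, hl]
  by_cases h : l ∈ Metric.closedBall (0 : Amp M) R
  · simp [Set.indicator_of_mem h]
  · have hgl : g l = 0 := by
      by_contra h0
      exact h (Metric.closedBall_subset_closedBall hR (hR₀ (subset_tsupport g h0)))
    simp [Set.indicator_of_notMem h, hgl]

variable (M) in
/-- The map that takes the matrix `(A_{nm})` to the Wigner transform of `A`. -/
noncomputable def wignerMap : OccMatrix M →L[ℂ] Lp ℂ 2 (volume : Measure (Amp M)) :=
  ((Real.pi : ℂ) ^ (2 * ∑ j, Fintype.card (M j)))⁻¹ • (symplFourierLp M).comp (charMap M)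

namespace RestrictedBasis

lemma tendsto_wignerMap (b : RestrictedBasis D M) (a : OccMatrix M) {χ : Amp M → ℂ}
    (hχ : χ =ᵐ[volume] charMap M a) :
    Tendsto (fun R : ℝ => eLpNorm (fun α : Amp M => wignerMap M a α -
      ((Real.pi : ℂ) ^ (2 * ∑ j, Fintype.card (M j)))⁻¹ *
        ∫ l in Metric.closedBall (0 : Amp M) R,
          (∏ j, b.displacementFunctional j l α) * χ l) 2 volume) atTop (𝓝 0) := by
  set c := ((Real.pi : ℂ) ^ (2 * ∑ j, Fintype.card (M j)))⁻¹ with hc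
  have h1 : Tendsto (fun R => c • symplFourierLp M (truncLp (charMap M a) R)) atTop
      (𝓝 (wignerMap M a)) :=
    (((symplFourierLp M).continuous.tendsto _).comp (tendsto_truncLp (charMap M a))).const_smul c
  refine tendsto_eLpNorm_sub h1 (fun R => ?_) (ae_eq_refl _)
  filter_upwards [Lp.coeFn_smul c (symplFourierLp M (truncLp (charMap M a) R)),
    symplFourierLp_ae_eq _ (integrable_truncLp (charMap M a) R)] with α h1 h2
  rw [h1, Pi.smul_apply, h2, smul_eq_mul, symplFourier]
  simp only [b.prod_displacementFunctional]
  congr 1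
  rw [← integral_indicator measurableSet_closedBall]
  refine integral_congr_ae ?_
  filter_upwards [coeFn_truncLp (charMap M a) R, hχ] with l h1 h2
  rw [h1]
  by_cases h : l ∈ Metric.closedBall (0 : Amp M) R
  · simp only [Set.indicator_of_mem h, h2]
  · simp only [Set.indicator_of_notMem h, mul_zero]

lemma isWignerTransform_wignerMap (b : RestrictedBasis D M) {A : Fock M →L[ℂ] Fock M}
    (hA : IsHilbertSchmidt A) : b.IsWignerTransform A (wignerMap M (hsMatrix hA)) :=
  ⟨Lp.memLp _, _, b.isCharacteristic_charMap hA, b.tendsto_wignerMap _ (ae_eq_refl _)⟩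

lemma isWignerTransform_wigner (b : RestrictedBasis D M) {A : Fock M →L[ℂ] Fock M}
    (hA : IsHilbertSchmidt A) : b.IsWignerTransform A (b.wigner A) := by
  have h : ∃ w, b.IsWignerTransform A w := ⟨_, b.isWignerTransform_wignerMap hA⟩
  rw [wigner, dif_pos h]
  exact h.choose_spec

lemma IsWignerTransform.ae_eq {b : RestrictedBasis D M} {A : Fock M →L[ℂ] Fock M}
    (hA : IsHilbertSchmidt A) {w : Amp M → ℂ} (h : b.IsWignerTransform A w) :
    w =ᵐ[volume] wignerMap M (hsMatrix hA) := by
  obtain ⟨hw, χ, hχ, ht⟩ := h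
  have hχ' := hχ.ae_eq hA
  refine ae_eq_of_tendsto_eLpNorm_sub (fun R => ?_) hw.1 (Lp.aestronglyMeasurable _) ht
    (b.tendsto_wignerMap _ hχ')
  have hint : Integrable ((Metric.closedBall (0 : Amp M) R).indicator χ) := by
    refine (integrable_truncLp (charMap M (hsMatrix hA)) R).congr ?_
    filter_upwards [coeFn_truncLp (charMap M (hsMatrix hA)) R, hχ'] with l h1 h2
    rw [h1]
    by_cases h : l ∈ Metric.closedBall (0 : Amp M) R
    · simp only [Set.indicator_of_mem h, h2]
    · simp only [Set.indicator_of_notMem h]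
  refine Continuous.aestronglyMeasurable (continuous_const.mul ?_)
  refine (continuous_symplFourier hint).congr fun α => ?_
  rw [symplFourier, ← integral_indicator measurableSet_closedBall]
  congr 1
  funext l
  simp only [b.prod_displacementFunctional]
  by_cases h : l ∈ Metric.closedBall (0 : Amp M) R
  · simp only [Set.indicator_of_mem h]
  · simp only [Set.indicator_of_notMem h, mul_zero]

end RestrictedBasis

end Modes

/-! ### Test functionals and the symplectic Fourier transform -/

section Modes

variable {D C : ℕ} {M : Fin C → Type*} [∀ j, Fintype (M j)] [∀ j, DecidableEq (M j)]

lemma continuous_lineDeriv {f : Amp M → ℂ} (hf : ContDiff ℝ 1 f) (v : Amp M) :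
    Continuous fun α => lineDeriv ℝ f α v := by
  have : (fun α => lineDeriv ℝ f α v) = fun α => fderiv ℝ f α v :=
    funext fun α => (hf.differentiable one_ne_zero α).lineDeriv_eq_fderiv
  rw [this]
  exact (hf.continuous_fderiv one_ne_zero).clm_apply continuous_const

lemma continuous_wirtinger {f : Amp M → ℂ} (hf : ContDiff ℝ 1 f) (i : Mode M) :
    Continuous (wirtinger i f) :=
  ((continuous_lineDeriv hf _).sub (continuous_const.mul (continuous_lineDeriv hf _))).div_const 2

lemma continuous_wirtingerConj {f : Amp M → ℂ} (hf : ContDiff ℝ 1 f) (i : Mode M) :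
    Continuous (wirtingerConj i f) :=
  ((continuous_lineDeriv hf _).add (continuous_const.mul (continuous_lineDeriv hf _))).div_const 2

lemma lineDeriv_eq_zero_of_notMem_tsupport {f : Amp M → ℂ} {α : Amp M} (h : α ∉ tsupport f)
    (v : Amp M) : lineDeriv ℝ f α v = 0 := by
  have h0 : f =ᶠ[𝓝 α] fun _ => 0 := notMem_tsupport_iff_eventuallyEq.1 h
  rw [h0.lineDeriv_eq]
  simp [lineDeriv]

lemma hasCompactSupport_wirtinger {f : Amp M → ℂ} (hf : HasCompactSupport f) (i : Mode M) :
    HasCompactSupport (wirtinger i f) :=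
  HasCompactSupport.intro hf.isCompact fun α hα => by
    simp [wirtinger, lineDeriv_eq_zero_of_notMem_tsupport hα]

lemma hasCompactSupport_wirtingerConj {f : Amp M → ℂ} (hf : HasCompactSupport f) (i : Mode M) :
    HasCompactSupport (wirtingerConj i f) :=
  HasCompactSupport.intro hf.isCompact fun α hα => by
    simp [wirtingerConj, lineDeriv_eq_zero_of_notMem_tsupport hα]

lemma IsTestFunctional.contDiff_one {η : Amp M → ℂ} (hη : IsTestFunctional η) : ContDiff ℝ 1 η :=
  hη.1.of_le (by exact_mod_cast le_top)

/-- The exponent of the kernel, a real-bilinear form. -/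
noncomputable def symplForm (l α : Amp M) : ℂ := ∑ i, (-(l i * conj (α i)) + conj (l i) * α i)

lemma symplKernel_eq_exp (l α : Amp M) : symplKernel l α = Complex.exp (symplForm l α) := rfl

lemma symplForm_add_smul_left (l v α : Amp M) (t : ℝ) :
    symplForm (l + t • v) α = symplForm l α + t * symplForm v α := by
  simp only [symplForm, Finset.mul_sum, ← Finset.sum_add_distrib]
  refine Finset.sum_congr rfl fun i _ => ?_
  simp
  ring

lemma symplForm_add_smul_right (l α v : Amp M) (t : ℝ) :
    symplForm l (α + t • v) = symplForm l α + t * symplForm l v := by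
  simp only [symplForm, Finset.mul_sum, ← Finset.sum_add_distrib]
  refine Finset.sum_congr rfl fun i _ => ?_
  simp
  ring

lemma hasDerivAt_exp_add_mul (a c : ℂ) :
    HasDerivAt (fun t : ℝ => Complex.exp (a + t * c)) (c * Complex.exp a) 0 := by
  have h1 : HasDerivAt (fun t : ℝ => a + (t : ℂ) * c) c 0 := by
    simpa using ((Complex.ofRealCLM.hasDerivAt (x := 0)).mul_const c).const_add a
  have h2 := h1.cexp
  simpa [mul_comm] using h2

lemma lineDeriv_symplKernel_left (l α v : Amp M) :
    lineDeriv ℝ (fun l => symplKernel l α) l v = symplForm v α * symplKernel l α := by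
  simp only [lineDeriv, symplKernel_eq_exp, symplForm_add_smul_left]
  exact (hasDerivAt_exp_add_mul _ _).deriv

lemma lineDeriv_symplKernel_right (l α v : Amp M) :
    lineDeriv ℝ (fun α => symplKernel l α) α v = symplForm l v * symplKernel l α := by
  simp only [lineDeriv, symplKernel_eq_exp, symplForm_add_smul_right]
  exact (hasDerivAt_exp_add_mul _ _).deriv

lemma symplForm_single_left (i : Mode M) (z : ℂ) (α : Amp M) :
    symplForm (Pi.single i z) α = -(z * conj (α i)) + conj z * α i := by
  rw [symplForm, Finset.sum_eq_single i (by intro q _ hq; simp [hq]) (by simp)]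
  simp

lemma symplForm_single_right (i : Mode M) (z : ℂ) (l : Amp M) :
    symplForm l (Pi.single i z) = -(l i * conj z) + conj (l i) * z := by
  rw [symplForm, Finset.sum_eq_single i (by intro q _ hq; simp [hq]) (by simp)]
  simp

lemma wirtinger_symplKernel_left (i : Mode M) (l α : Amp M) :
    wirtinger i (fun l => symplKernel l α) l = -conj (α i) * symplKernel l α := by
  rw [wirtinger, lineDeriv_symplKernel_left, lineDeriv_symplKernel_left, symplForm_single_left,
    symplForm_single_left, map_one, Complex.conj_I]
  linear_combination ((conj (α i) + α i) * symplKernel l α / 2) * Complex.I_mul_I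

lemma wirtingerConj_symplKernel_left (i : Mode M) (l α : Amp M) :
    wirtingerConj i (fun l => symplKernel l α) l = α i * symplKernel l α := by
  rw [wirtingerConj, lineDeriv_symplKernel_left, lineDeriv_symplKernel_left,
    symplForm_single_left, symplForm_single_left, map_one, Complex.conj_I]
  linear_combination (-(conj (α i) + α i) * symplKernel l α / 2) * Complex.I_mul_I

lemma wirtinger_symplKernel_right (i : Mode M) (l α : Amp M) :
    wirtinger i (fun α => symplKernel l α) α = conj (l i) * symplKernel l α := by
  rw [wirtinger, lineDeriv_symplKernel_right, lineDeriv_symplKernel_right,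
    symplForm_single_right, symplForm_single_right, map_one, Complex.conj_I]
  linear_combination (-(conj (l i) + l i) * symplKernel l α / 2) * Complex.I_mul_I

lemma wirtingerConj_symplKernel_right (i : Mode M) (l α : Amp M) :
    wirtingerConj i (fun α => symplKernel l α) α = -l i * symplKernel l α := by
  rw [wirtingerConj, lineDeriv_symplKernel_right, lineDeriv_symplKernel_right,
    symplForm_single_right, symplForm_single_right, map_one, Complex.conj_I]
  linear_combination ((conj (l i) + l i) * symplKernel l α / 2) * Complex.I_mul_I

lemma differentiable_symplKernel_left (α : Amp M) :
    Differentiable ℝ fun l => symplKernel l α := by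
  have hconj : Differentiable ℝ fun z : ℂ => conj z := Complex.conjCLE.differentiable
  unfold symplKernel
  fun_prop

lemma differentiable_symplKernel_right (l : Amp M) :
    Differentiable ℝ fun α => symplKernel l α := by
  have hconj : Differentiable ℝ fun z : ℂ => conj z := Complex.conjCLE.differentiable
  unfold symplKernel
  fun_prop

/-- Multiplication by coordinates on the Fourier side of a matrix element. -/
lemma coord_mul_symplFourier_dispFun (i : Mode M) (m n : Occ M) (α : Amp M) :
    α i * symplFourier (dispFun m n) α = -symplFourier (wirtingerConj i (dispFun m n)) α ∧
    conj (α i) * symplFourier (dispFun m n) α = symplFourier (wirtinger i (dispFun m n)) α := by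
  have hK : ∀ {f : Amp M → ℂ}, f ∈ dispSpan M → Integrable fun l => symplKernel l α * f l :=
    fun hf => integrable_symplKernel_mul (integrable_of_mem_dispSpan hf) α
  have hD := dispFun_mem_dispSpan m n
  have h := integral_mul_wirtinger_and_conj (f := fun l => symplKernel l α) (g := dispFun m n)
    (differentiable_symplKernel_left α) (differentiable_dispFun m n) (hK hD) i
    (by simp only [wirtinger_symplKernel_left, mul_assoc]
        exact (hK hD).const_mul _)
    (by simp only [wirtingerConj_symplKernel_left, mul_assoc]
        exact (hK hD).const_mul _)
    (hK (wirtinger_dispFun_mem i m n)) (hK (wirtingerConj_dispFun_mem i m n))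
  simp only [wirtinger_symplKernel_left, wirtingerConj_symplKernel_left, mul_assoc,
    integral_const_mul] at h
  simp only [symplFourier]
  exact ⟨by rw [h.2, neg_neg], by rw [h.1]; ring⟩

/-- The Fourier integral of a test functional. -/
noncomputable def testFourier (η : Amp M → ℂ) (l : Amp M) : ℂ := ∫ α, symplKernel l α * η α

lemma integrable_symplKernel_mul_right {f : Amp M → ℂ} (hf : Integrable f) (l : Amp M) :
    Integrable fun α => symplKernel l α * f α := by
  refine hf.bdd_mul (c := 1) ?_ (ae_of_all _ fun α => (norm_symplKernel l α).le)
  exact (continuous_symplKernel.comp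
    (by fun_prop : Continuous fun α : Amp M => (l, α))).aestronglyMeasurable

lemma continuous_testFourier {η : Amp M → ℂ} (hη : Integrable η) : Continuous (testFourier η) := by
  refine continuous_of_dominated (bound := fun α => ‖η α‖)
    (fun l => (integrable_symplKernel_mul_right hη l).aestronglyMeasurable)
    (fun l => ae_of_all _ fun α => ?_) hη.norm (ae_of_all _ fun α => ?_)
  · rw [norm_mul, norm_symplKernel, one_mul]
  · exact (continuous_symplKernel.comp
      (by fun_prop : Continuous fun l : Amp M => (l, α))).mul continuous_const

lemma norm_testFourier_le (η : Amp M → ℂ) (l : Amp M) : ‖testFourier η l‖ ≤ ∫ α, ‖η α‖ := by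
  refine (norm_integral_le_integral_norm _).trans (le_of_eq ?_)
  simp only [norm_mul, norm_symplKernel, one_mul]

lemma integrable_mul_testFourier {f η : Amp M → ℂ} (hf : Integrable f) (hη : Integrable η) :
    Integrable fun l => f l * testFourier η l :=
  hf.mul_bdd (continuous_testFourier hη).aestronglyMeasurable
    (ae_of_all _ fun l => norm_testFourier_le η l)

lemma integral_symplFourier_mul {f η : Amp M → ℂ} (hf : Integrable f) (hη : Integrable η) :
    ∫ α, symplFourier f α * η α = ∫ l, f l * testFourier η l := by
  have hprod : Integrable (fun p : Amp M × Amp M => symplKernel p.2 p.1 * (η p.1 * f p.2))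
      (volume.prod volume) := by
    refine (hη.mul_prod hf).bdd_mul (c := 1) ?_ (ae_of_all _ fun p => (norm_symplKernel _ _).le)
    exact (continuous_symplKernel.comp
      (by fun_prop : Continuous fun p : Amp M × Amp M => (p.2, p.1))).aestronglyMeasurable
  have h := integral_integral_swap (f := fun α l => symplKernel l α * (η α * f l)) hprod
  calc _ = ∫ α, ∫ l, symplKernel l α * (η α * f l) := by
        congr 1; funext α
        rw [symplFourier, ← integral_mul_const]
        congr 1; funext l; ring
    _ = ∫ l, ∫ α, symplKernel l α * (η α * f l) := h
    _ = _ := by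
        congr 1; funext l
        rw [testFourier, ← integral_const_mul]
        congr 1; funext α; ring

namespace IsTestFunctional

variable {η : Amp M → ℂ}

lemma integrable (hη : IsTestFunctional η) : Integrable η :=
  hη.1.continuous.integrable_of_hasCompactSupport hη.2

lemma integrable_wirtinger (hη : IsTestFunctional η) (i : Mode M) : Integrable (wirtinger i η) :=
  (continuous_wirtinger hη.contDiff_one i).integrable_of_hasCompactSupport
    (hasCompactSupport_wirtinger hη.2 i)

lemma integrable_wirtingerConj (hη : IsTestFunctional η) (i : Mode M) :
    Integrable (wirtingerConj i η) :=
  (continuous_wirtingerConj hη.contDiff_one i).integrable_of_hasCompactSupport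
    (hasCompactSupport_wirtingerConj hη.2 i)

lemma testFourier_wirtinger (hη : IsTestFunctional η) (i : Mode M) (l : Amp M) :
    testFourier (wirtinger i η) l = -(conj (l i) * testFourier η l) ∧
    testFourier (wirtingerConj i η) l = l i * testFourier η l := by
  have hK := integrable_symplKernel_mul_right hη.integrable l
  have h := integral_mul_wirtinger_and_conj (f := fun α => symplKernel l α) (g := η)
    (differentiable_symplKernel_right l) (hη.contDiff_one.differentiable one_ne_zero) hK i
    (by simp only [wirtinger_symplKernel_right, mul_assoc]
        exact hK.const_mul _)
    (by simp only [wirtingerConj_symplKernel_right, mul_assoc]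
        exact hK.const_mul _)
    (integrable_symplKernel_mul_right (hη.integrable_wirtinger i) l)
    (integrable_symplKernel_mul_right (hη.integrable_wirtingerConj i) l)
  simp only [wirtinger_symplKernel_right, wirtingerConj_symplKernel_right, mul_assoc,
    integral_const_mul] at h
  simp only [testFourier]
  exact ⟨h.1, by rw [h.2]; ring⟩

end IsTestFunctional

/-- The differential operator `α_q ∂_p - α_p^* ∂_q^*`, the formal adjoint of
`-∂_p α_q + ∂_q^* α_p^*`. -/
noncomputable def transferOp (p q : Mode M) (η : Amp M → ℂ) (α : Amp M) : ℂ :=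
  α q * wirtinger p η α - conj (α p) * wirtingerConj q η α

lemma IsTestFunctional.continuous_transferOp {η : Amp M → ℂ} (hη : IsTestFunctional η)
    (p q : Mode M) : Continuous (transferOp p q η) :=
  ((continuous_apply q).mul (continuous_wirtinger hη.contDiff_one p)).sub
    ((Complex.continuous_conj.comp (continuous_apply p)).mul
      (continuous_wirtingerConj hη.contDiff_one q))

lemma IsTestFunctional.hasCompactSupport_transferOp {η : Amp M → ℂ} (hη : IsTestFunctional η)
    (p q : Mode M) : HasCompactSupport (transferOp p q η) :=
  HasCompactSupport.intro hη.2.isCompact fun α hα => by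
    simp [transferOp, wirtinger, wirtingerConj, lineDeriv_eq_zero_of_notMem_tsupport hα]

/-- The Heisenberg commutator `[D, a_p† a_q]` of the displacement operators, as a differential
operator in `λ`. -/
lemma commutator_dispFun (p q : Mode M) (m n : Occ M) (l : Amp M) :
    conj (l p) * wirtingerConj q (dispFun m n) l - l q * wirtinger p (dispFun m n) l =
      create q (annihilate p fun n => dispFun m n l) n -
        create p (annihilate q fun m => dispFun m n l) m := by
  have e1 := coord_mul_dispFun q (m - Pi.single p 1) n l
  have e2 := conj_coord_mul_dispFun p m (n - Pi.single q 1) l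
  rw [wirtingerConj_dispFun, wirtinger_dispFun]
  simp only [create, annihilate]
  linear_combination (-(Real.sqrt (m p) : ℂ)) * e1 - (Real.sqrt (n q) : ℂ) * e2

lemma integral_coord_mul {η : Amp M → ℂ} (hη : IsTestFunctional η) (p q : Mode M) (m n : Occ M) :
    ∫ α, symplFourier (dispFun m n) α * transferOp p q η α =
      ∫ l, (conj (l p) * wirtingerConj q (dispFun m n) l - l q * wirtinger p (dispFun m n) l) *
        testFourier η l := by
  have s1 := wirtingerConj_dispFun_mem q m n
  have s2 := wirtinger_dispFun_mem p m n
  have i1 : Integrable fun α => symplFourier (wirtingerConj q (dispFun m n)) α * wirtinger p η α :=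
    ((continuous_symplFourier (integrable_of_mem_dispSpan s1)).mul
      (continuous_wirtinger hη.contDiff_one p)).integrable_of_hasCompactSupport
      (hasCompactSupport_wirtinger hη.2 p).mul_left
  have i2 : Integrable fun α => symplFourier (wirtinger p (dispFun m n)) α * wirtingerConj q η α :=
    ((continuous_symplFourier (integrable_of_mem_dispSpan s2)).mul
      (continuous_wirtingerConj hη.contDiff_one q)).integrable_of_hasCompactSupport
      (hasCompactSupport_wirtingerConj hη.2 q).mul_left
  have j1 := integrable_mul_testFourier
    (integrable_of_mem_dispSpan (conj_coord_mul_mem_dispSpan p s1)) hη.integrable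
  have j2 := integrable_mul_testFourier
    (integrable_of_mem_dispSpan (coord_mul_mem_dispSpan q s2)) hη.integrable
  calc _ = ∫ α, (-(symplFourier (wirtingerConj q (dispFun m n)) α * wirtinger p η α) -
        symplFourier (wirtinger p (dispFun m n)) α * wirtingerConj q η α) := by
        congr 1; funext α
        have e1 := (coord_mul_symplFourier_dispFun q m n α).1
        have e2 := (coord_mul_symplFourier_dispFun p m n α).2
        rw [transferOp]
        linear_combination wirtinger p η α * e1 - wirtingerConj q η α * e2
    _ = -(∫ l, wirtingerConj q (dispFun m n) l * testFourier (wirtinger p η) l) -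
        ∫ l, wirtinger p (dispFun m n) l * testFourier (wirtingerConj q η) l := by
        have i1' : Integrable fun α =>
            -(symplFourier (wirtingerConj q (dispFun m n)) α * wirtinger p η α) := i1.neg
        rw [integral_sub i1' i2, integral_neg,
          integral_symplFourier_mul (integrable_of_mem_dispSpan s1) (hη.integrable_wirtinger p),
          integral_symplFourier_mul (integrable_of_mem_dispSpan s2)
            (hη.integrable_wirtingerConj q)]
    _ = ∫ l, ((conj (l p) * wirtingerConj q (dispFun m n) l) * testFourier η l -
          (l q * wirtinger p (dispFun m n) l) * testFourier η l) := by
        rw [integral_sub j1 j2, ← integral_neg]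
        congr 1
        · congr 1; funext l
          rw [(hη.testFourier_wirtinger p l).1]; ring
        · congr 1; funext l
          rw [(hη.testFourier_wirtinger q l).2]; ring
    _ = _ := by
        congr 1; funext l; ring

/-- The pairing of the Fourier transform of a matrix element with a test functional. -/
noncomputable def dispPairing (η : Amp M → ℂ) (m n : Occ M) : ℂ :=
  ∫ l, dispFun m n l * testFourier η l

lemma integral_symplFourier_dispFun_mul {η : Amp M → ℂ} (hη : Integrable η) (m n : Occ M) :
    ∫ α, symplFourier (dispFun m n) α * η α = dispPairing η m n :=
  integral_symplFourier_mul (integrable_dispFun m n) hη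

/-- On matrix elements, `transferOp p q` acts as the commutator with `a_p† a_q`. -/
lemma dispPairing_transferOp {η : Amp M → ℂ} (hη : IsTestFunctional η) (p q : Mode M)
    (m n : Occ M) :
    dispPairing (transferOp p q η) m n = create q (annihilate p fun n => dispPairing η m n) n -
        create p (annihilate q fun m => dispPairing η m n) m := by
  have hT : Integrable (transferOp p q η) :=
    (hη.continuous_transferOp p q).integrable_of_hasCompactSupport
      (hη.hasCompactSupport_transferOp p q)
  rw [← integral_symplFourier_dispFun_mul hT, integral_coord_mul hη]
  simp only [commutator_dispFun, create, annihilate, dispPairing, sub_mul]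
  have hi := fun m n : Occ M => integrable_mul_testFourier (integrable_dispFun m n) hη.integrable
  rw [← integral_const_mul, ← integral_const_mul, ← integral_const_mul, ← integral_const_mul,
    ← integral_sub]
  · congr 1; funext l; ring
  · exact ((hi _ _).const_mul _).const_mul _
  · exact ((hi _ _).const_mul _).const_mul _

end Modes

/-! ### The weak identity -/

section Modes

variable {D C : ℕ} {M : Fin C → Type*} [∀ j, Fintype (M j)] [∀ j, DecidableEq (M j)]

/-- Pairing the Wigner transform with a test function is an absolutely convergent trace. -/
lemma hasSum_wignerMap_pairing (a : OccMatrix M) {ζ : Amp M → ℂ} (hζ : Continuous ζ)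
    (hζc : HasCompactSupport ζ) :
    HasSum (fun p : Occ M × Occ M => a p *
      (((Real.pi : ℂ) ^ (2 * ∑ j, Fintype.card (M j)))⁻¹ * dispPairing ζ p.2 p.1))
      (∫ α, wignerMap M a α * ζ α) := by
  set c := ((Real.pi : ℂ) ^ (2 * ∑ j, Fintype.card (M j)))⁻¹ with hc
  have hm : MemLp (fun α => conj (ζ α)) 2 volume :=
    (hζ.memLp_of_hasCompactSupport hζc).star
  have hpair : ∀ f : Lp ℂ 2 (volume : Measure (Amp M)),
      innerSL ℂ (hm.toLp _) f = ∫ α, f α * ζ α := fun f => by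
    rw [innerSL_apply_apply, L2.inner_def]
    refine integral_congr_ae ?_
    filter_upwards [hm.coeFn_toLp] with α hα
    rw [hα, RCLike.inner_apply, Complex.conj_conj]
  have h := (((hasSum_charMap a).mapL (symplFourierLp M)).const_smul c).mapL
    (innerSL ℂ (hm.toLp _))
  have h' : HasSum (fun p : Occ M × Occ M => innerSL ℂ (hm.toLp _)
      (c • symplFourierLp M (a p • dispLp p.2 p.1))) (∫ α, wignerMap M a α * ζ α) := by
    rw [← hpair]
    exact h
  refine h'.congr_fun fun p => ?_
  have hint : Integrable (dispLp p.2 p.1) :=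
    (integrable_dispFun p.2 p.1).congr (coeFn_dispLp p.2 p.1).symm
  have hval : innerSL ℂ (hm.toLp _) (symplFourierLp M (dispLp p.2 p.1)) =
      dispPairing ζ p.2 p.1 := by
    rw [hpair, ← integral_symplFourier_dispFun_mul (hζ.integrable_of_hasCompactSupport hζc)]
    refine integral_congr_ae ?_
    filter_upwards [symplFourierLp_ae_eq _ hint] with α hα
    rw [hα]
    congr 1
    refine integral_congr_ae ?_
    filter_upwards [coeFn_dispLp p.2 p.1] with l hl
    rw [hl]
  rw [map_smul, map_smul, map_smul, hval, smul_eq_mul, smul_eq_mul]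
  ring

variable (M) in
/-- The occupation numbers of at most `K` particles. -/
def occLE (K : ℕ) : Finset (Occ M) :=
  (Fintype.piFinset fun _ => Finset.range (K + 1)).filter fun m => ∑ i, m i ≤ K

lemma mem_occLE {K : ℕ} {m : Occ M} : m ∈ occLE M K ↔ ∑ i, m i ≤ K := by
  rw [occLE, Finset.mem_filter, and_iff_right_iff_imp]
  intro h
  rw [Fintype.mem_piFinset]
  intro i
  have := Finset.single_le_sum (f := m) (fun _ _ => Nat.zero_le _) (Finset.mem_univ i)
  rw [Finset.mem_range]
  omega

lemma tendsto_occLE_prod : Tendsto (fun K => occLE M (K + 1) ×ˢ occLE M (K + 1)) atTop atTop := by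
  refine tendsto_atTop_finset_of_monotone (fun K K' h p hp => ?_) fun p => ?_
  · rw [Finset.mem_product, mem_occLE, mem_occLE] at hp ⊢
    omega
  · refine ⟨∑ i, p.1 i + ∑ i, p.2 i, ?_⟩
    rw [Finset.mem_product, mem_occLE, mem_occLE]
    omega

lemma sum_add_single (m : Occ M) (p : Mode M) :
    ∑ i, (m + Pi.single p 1 : Occ M) i = ∑ i, m i + 1 := by
  simp [Finset.sum_add_distrib]

lemma sub_single_add_single {m : Occ M} {p : Mode M} (h : m p ≠ 0) :
    m - Pi.single p 1 + Pi.single p 1 = m := by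
  funext i
  by_cases hi : i = p
  · subst hi; simp; omega
  · simp [hi]

/-- Creation and annihilation are transposes of each other, also when truncated: creation raises
the particle number by one. -/
lemma sum_create_mul (p : Mode M) (K : ℕ) (c d : Occ M → ℂ) :
    ∑ m ∈ occLE M (K + 1), create p c m * d m = ∑ m ∈ occLE M K, c m * annihilate p d m := by
  have hsub : (occLE M K).map (addRightEmbedding (Pi.single p 1)) ⊆ occLE M (K + 1) := by
    intro m hm
    obtain ⟨m', hm', rfl⟩ := Finset.mem_map.1 hm
    rw [mem_occLE] at hm' ⊢
    rw [addRightEmbedding_apply, sum_add_single]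
    omega
  rw [← Finset.sum_subset hsub, Finset.sum_map]
  · refine Finset.sum_congr rfl fun m _ => ?_
    simp only [create, annihilate, addRightEmbedding_apply, add_tsub_cancel_right, Pi.add_apply,
      Pi.single_eq_same]
    push_cast
    ring
  · intro m hm hm'
    have : m p = 0 := by
      by_contra h
      refine hm' (Finset.mem_map.2 ⟨m - Pi.single p 1, ?_, ?_⟩)
      · have e := sum_add_single (m - Pi.single p 1) p
        rw [sub_single_add_single h] at e
        rw [mem_occLE] at hm ⊢
        omega
      · exact sub_single_add_single h
    simp [create, this]

/-- Each `a_p† a_q` preserves the particle number, so truncation to at most `K` particles does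
not disturb the transposition `(a_p† a_q)ᵀ = a_q† a_p`. -/
lemma sum_create_annihilate_mul (p q : Mode M) (K : ℕ) (c d : Occ M → ℂ) :
    ∑ m ∈ occLE M (K + 1), create p (annihilate q c) m * d m =
      ∑ m ∈ occLE M (K + 1), c m * create q (annihilate p d) m := by
  rw [sum_create_mul]
  simp only [mul_comm (c _)]
  rw [sum_create_mul]
  exact Finset.sum_congr rfl fun m _ => mul_comm _ _

/-- The truncated trace of a commutator with `a_p† a_q` against a matrix `d`, with the commutator
moved to `d`. -/
lemma sum_commutator_mul (p q : Mode M) (K : ℕ) (a d : Occ M → Occ M → ℂ) :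
    ∑ n ∈ occLE M (K + 1), ∑ m ∈ occLE M (K + 1), a n m *
      (create q (annihilate p fun n => d n m) n - create p (annihilate q fun m => d n m) m) =
    ∑ n ∈ occLE M (K + 1), ∑ m ∈ occLE M (K + 1),
      (create p (annihilate q fun n => a n m) n - create q (annihilate p fun m => a n m) m) *
        d n m := by
  simp only [mul_sub, sub_mul, Finset.sum_sub_distrib]
  congr 1
  · refine Finset.sum_comm.trans (Eq.trans ?_ Finset.sum_comm)
    exact Finset.sum_congr rfl fun m _ =>
      (sum_create_annihilate_mul p q K (fun n => a n m) (fun n => d n m)).symm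
  · exact Finset.sum_congr rfl fun n _ => (sum_create_annihilate_mul q p K (a n) (d n)).symm

lemma annihilate_numberState (q : Mode M) (m n : Occ M) :
    annihilate q (numberState m : Fock M) n =
      (Real.sqrt (m q) : ℂ) * (numberState (m - Pi.single q 1) : Fock M) n := by
  rw [annihilate, numberState_apply, numberState_apply]
  by_cases h : n + Pi.single q 1 = m
  · subst h
    simp
  · rw [if_neg h, mul_zero]
    by_cases h' : n = m - Pi.single q 1
    · have : m q = 0 := by
        by_contra h0
        exact h (by rw [h', sub_single_add_single h0])
      simp [this]
    · rw [if_neg h', mul_zero]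

lemma create_numberState (p : Mode M) (m n : Occ M) :
    create p (numberState m : Fock M) n =
      (Real.sqrt (m p + 1 : ℝ) : ℂ) * (numberState (m + Pi.single p 1) : Fock M) n := by
  rw [create, numberState_apply, numberState_apply]
  by_cases h : n = m + Pi.single p 1
  · subst h
    simp
  · rw [if_neg h, mul_zero]
    by_cases h' : n - Pi.single p 1 = m
    · have : n p = 0 := by
        by_contra h0
        exact h (by rw [← h', sub_single_add_single h0])
      simp [this]
    · rw [if_neg h', mul_zero]

lemma create_annihilate_numberState (p q : Mode M) (m n : Occ M) :
    create p (annihilate q (numberState m : Fock M)) n =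
      ((Real.sqrt (m q) : ℂ) * (Real.sqrt ((m - Pi.single q 1 : Occ M) p + 1 : ℝ) : ℂ)) *
        (numberState (m - Pi.single q 1 + Pi.single p 1) : Fock M) n := by
  have h := create_numberState p (m - Pi.single q 1) n
  rw [mul_assoc, ← h]
  simp only [create, annihilate_numberState]
  ring

lemma sum_sum_sum_sum_comm {ι κ N R : Type*} [Fintype ι] [Fintype κ] [AddCommMonoid R]
    (S : Finset N) (f : ι → κ → N → N → R) :
    ∑ n ∈ S, ∑ m ∈ S, ∑ p, ∑ q, f p q n m = ∑ p, ∑ q, ∑ n ∈ S, ∑ m ∈ S, f p q n m := by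
  calc _ = ∑ n ∈ S, ∑ p, ∑ q, ∑ m ∈ S, f p q n m := by
        refine Finset.sum_congr rfl fun n _ => ?_
        rw [Finset.sum_comm]
        exact Finset.sum_congr rfl fun p _ => Finset.sum_comm
    _ = _ := by
        rw [Finset.sum_comm]
        exact Finset.sum_congr rfl fun p _ => Finset.sum_comm

namespace RestrictedBasis

variable (b : RestrictedBasis D M)

/-- The matrix elements of the commutator with `∫ dx Ψ̃_j† Ψ̃_k`. -/
lemma commutator_apply {j k : Fin C} {A B : Fock M →L[ℂ] Fock M}
    (hAB : IsCommutator (b.bilinearOp j k) A B) (n m : Occ M) :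
    B (numberState m) n = ∑ p, ∑ q, b.overlap j k p q *
      (create ⟨j, p⟩ (annihilate ⟨k, q⟩ fun n => A (numberState m) n) n -
        create ⟨k, q⟩ (annihilate ⟨j, p⟩ fun m => A (numberState m) n) m) := by
  set u : Fock M := ∑ p, ∑ q, (b.overlap j k p q * ((Real.sqrt (m ⟨k, q⟩) : ℂ) *
    (Real.sqrt ((m - Pi.single ⟨k, q⟩ 1 : Occ M) ⟨j, p⟩ + 1 : ℝ) : ℂ))) •
      numberState (m - Pi.single ⟨k, q⟩ 1 + Pi.single ⟨j, p⟩ 1) with hu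
  have hT : (u : Occ M → ℂ) = b.bilinearOp j k (numberState m : Fock M) := by
    funext n'
    rw [bilinearOp_apply, hu]
    simp only [lp.coeFn_sum, Finset.sum_apply, lp.coeFn_smul, Pi.smul_apply, smul_eq_mul,
      create_annihilate_numberState]
    refine Finset.sum_congr rfl fun p _ => Finset.sum_congr rfl fun q _ => ?_
    ring
  have hfin : (Function.support ((numberState m : Fock M) : Occ M → ℂ)).Finite := by
    refine (Set.finite_singleton m).subset fun n' hn' => ?_
    by_contra h
    exact hn' (by rw [numberState_apply, if_neg (fun e => h (by simp [e]))])
  have h := congrFun (hAB (numberState m) u hfin hT) n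
  rw [h, Pi.sub_apply, bilinearOp_apply, hu]
  simp only [map_sum, map_smul, lp.coeFn_sum, Finset.sum_apply, lp.coeFn_smul, Pi.smul_apply,
    smul_eq_mul, ← Finset.sum_sub_distrib]
  refine Finset.sum_congr rfl fun p _ => Finset.sum_congr rfl fun q _ => ?_
  simp only [create, annihilate]
  ring

/-- The weak form of the correspondence, in terms of mode amplitudes: both sides are traces, which
agree when truncated to finitely many particles. -/
lemma integral_wignerMap_commutator {j k : Fin C} {A B : Fock M →L[ℂ] Fock M}
    (hA : IsHilbertSchmidt A) (hB : IsHilbertSchmidt B)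
    (hAB : IsCommutator (b.bilinearOp j k) A B) {η : Amp M → ℂ} (hη : IsTestFunctional η) :
    ∫ α, wignerMap M (hsMatrix hB) α * η α = ∑ p, ∑ q, b.overlap j k p q *
      ∫ α, wignerMap M (hsMatrix hA) α * transferOp ⟨j, p⟩ ⟨k, q⟩ η α := by
  have hL := hasSum_wignerMap_pairing (hsMatrix hB) hη.1.continuous hη.2
  have hR : HasSum (fun x : Occ M × Occ M => ∑ p, ∑ q, b.overlap j k p q * (hsMatrix hA x *
      (((Real.pi : ℂ) ^ (2 * ∑ j, Fintype.card (M j)))⁻¹ *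
        dispPairing (transferOp ⟨j, p⟩ ⟨k, q⟩ η) x.2 x.1))) _ :=
    hasSum_sum fun p _ => hasSum_sum fun q _ => (hasSum_wignerMap_pairing (hsMatrix hA)
      (hη.continuous_transferOp ⟨j, p⟩ ⟨k, q⟩)
      (hη.hasCompactSupport_transferOp ⟨j, p⟩ ⟨k, q⟩)).mul_left (b.overlap j k p q)
  refine tendsto_nhds_unique (hL.comp tendsto_occLE_prod)
    ((hR.comp tendsto_occLE_prod).congr fun K => ?_)
  set c := ((Real.pi : ℂ) ^ (2 * ∑ j, Fintype.card (M j)))⁻¹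
  simp only [Function.comp_apply, Finset.sum_product, hsMatrix_apply, b.commutator_apply hAB,
    dispPairing_transferOp hη]
  set S := occLE M (K + 1) with hS
  have key := fun p q => sum_commutator_mul ⟨j, p⟩ ⟨k, q⟩ K (fun n m => A (numberState m) n)
    (fun n m => dispPairing η m n)
  have hl := sum_sum_sum_sum_comm S fun p q n m => b.overlap j k p q * (A (numberState m) n *
    (c * (create ⟨k, q⟩ (annihilate ⟨j, p⟩ fun n => dispPairing η m n) n -
      create ⟨j, p⟩ (annihilate ⟨k, q⟩ fun m => dispPairing η m n) m)))
  have hr := sum_sum_sum_sum_comm S fun p q n m => b.overlap j k p q *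
    (create ⟨j, p⟩ (annihilate ⟨k, q⟩ fun n => A (numberState m) n) n -
      create ⟨k, q⟩ (annihilate ⟨j, p⟩ fun m => A (numberState m) n) m) * (c * dispPairing η m n)
  simp only [Finset.sum_mul]
  refine hl.trans (Eq.trans ?_ hr.symm)
  refine Finset.sum_congr rfl fun p _ => Finset.sum_congr rfl fun q _ => ?_
  have h := congrArg (b.overlap j k p q * c * ·) (key p q)
  simp only [Finset.mul_sum] at h
  refine Eq.trans ?_ (h.trans ?_)
  · exact Finset.sum_congr rfl fun n _ => Finset.sum_congr rfl fun m _ => by ring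
  · exact Finset.sum_congr rfl fun n _ => Finset.sum_congr rfl fun m _ => by ring

end RestrictedBasis

end Modes

/-! ### Functional derivatives -/

section Modes

variable {D C : ℕ} {M : Fin C → Type*} [∀ j, Fintype (M j)] [∀ j, DecidableEq (M j)]

lemma integrable_memLp_mul {w c : Amp M → ℂ} (hw : MemLp w 2) (hc : Continuous c)
    (hcs : HasCompactSupport c) : Integrable fun α => w α * c α :=
  MemLp.integrable_mul (p := 2) (q := 2) hw (hc.memLp_of_hasCompactSupport hcs)

lemma lineDeriv_sum_const_mul {ι : Type*} [Fintype ι] (c : ι → ℂ) {f : ι → Amp M → ℂ}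
    (hf : ∀ q, Differentiable ℝ (f q)) (α v : Amp M) :
    lineDeriv ℝ (fun β => ∑ q, c q * f q β) α v = ∑ q, c q * lineDeriv ℝ (f q) α v := by
  have h := HasFDerivAt.fun_sum (u := Finset.univ) fun q _ =>
    ((hf q α).hasFDerivAt.const_mul (c q))
  rw [(h.hasLineDerivAt v).lineDeriv, sum_apply]
  exact Finset.sum_congr rfl fun q _ => by
    rw [(hf q α).lineDeriv_eq_fderiv]; rfl

lemma wirtinger_sum_const_mul {ι : Type*} [Fintype ι] (i : Mode M) (c : ι → ℂ)
    {f : ι → Amp M → ℂ} (hf : ∀ q, Differentiable ℝ (f q)) (α : Amp M) :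
    wirtinger i (fun β => ∑ q, c q * f q β) α = ∑ q, c q * wirtinger i (f q) α := by
  have h := lineDeriv_sum_const_mul c hf α
  simp only [wirtinger, h, Finset.mul_sum, ← Finset.sum_sub_distrib, Finset.sum_div]
  exact Finset.sum_congr rfl fun q _ => by ring

lemma wirtingerConj_sum_const_mul {ι : Type*} [Fintype ι] (i : Mode M) (c : ι → ℂ)
    {f : ι → Amp M → ℂ} (hf : ∀ q, Differentiable ℝ (f q)) (α : Amp M) :
    wirtingerConj i (fun β => ∑ q, c q * f q β) α = ∑ q, c q * wirtingerConj i (f q) α := by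
  have h := lineDeriv_sum_const_mul c hf α
  simp only [wirtingerConj, h, Finset.mul_sum, ← Finset.sum_add_distrib, Finset.sum_div]
  exact Finset.sum_congr rfl fun q _ => by ring

lemma contDiff_coord_mul {w : Amp M → ℂ} (hw : ContDiff ℝ 1 w) (q : Mode M) :
    ContDiff ℝ 1 fun α : Amp M => α q * w α :=
  (contDiff_apply ℝ ℂ q).mul hw

lemma contDiff_conj_coord_mul {w : Amp M → ℂ} (hw : ContDiff ℝ 1 w) (p : Mode M) :
    ContDiff ℝ 1 fun α : Amp M => conj (α p) * w α :=
  (Complex.conjCLE.contDiff.comp (contDiff_apply ℝ ℂ p)).mul hw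

/-- The differential operator dual to `transferOp`. -/
noncomputable def transferOpDual (p q : Mode M) (w : Amp M → ℂ) (α : Amp M) : ℂ :=
  -wirtinger p (fun β => β q * w β) α + wirtingerConj q (fun β => conj (β p) * w β) α

lemma continuous_transferOpDual {w : Amp M → ℂ} (hw : ContDiff ℝ 1 w) (p q : Mode M) :
    Continuous (transferOpDual p q w) :=
  (continuous_wirtinger (contDiff_coord_mul hw q) p).neg.add
    (continuous_wirtingerConj (contDiff_conj_coord_mul hw p) q)

lemma integrable_mul_of_hasCompactSupport_right {f g : Amp M → ℂ} (hf : Continuous f)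
    (hg : Continuous g) (hgs : HasCompactSupport g) : Integrable fun α => f α * g α :=
  (hf.mul hg).integrable_of_hasCompactSupport hgs.mul_left

/-- Against a test functional, integration by parts needs no decay of the other factor. -/
lemma IsTestFunctional.integral_mul_wirtinger_and_conj {η : Amp M → ℂ} (hη : IsTestFunctional η)
    {f : Amp M → ℂ} (hf : ContDiff ℝ 1 f) (i : Mode M) :
    (∫ α, f α * wirtinger i η α = -∫ α, wirtinger i f α * η α) ∧
      ∫ α, f α * wirtingerConj i η α = -∫ α, wirtingerConj i f α * η α := by
  have h1 := hη.contDiff_one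
  exact FunctionalWigner.integral_mul_wirtinger_and_conj (hf.differentiable one_ne_zero)
    (h1.differentiable one_ne_zero)
    (integrable_mul_of_hasCompactSupport_right hf.continuous h1.continuous hη.2) i
    (integrable_mul_of_hasCompactSupport_right (continuous_wirtinger hf i) h1.continuous hη.2)
    (integrable_mul_of_hasCompactSupport_right (continuous_wirtingerConj hf i) h1.continuous hη.2)
    (integrable_mul_of_hasCompactSupport_right hf.continuous (continuous_wirtinger h1 i)
      (hasCompactSupport_wirtinger hη.2 i))
    (integrable_mul_of_hasCompactSupport_right hf.continuous (continuous_wirtingerConj h1 i)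
      (hasCompactSupport_wirtingerConj hη.2 i))

/-- Moving the derivatives from the test functional to a continuously differentiable functional. -/
lemma IsTestFunctional.integral_mul_transferOp {η : Amp M → ℂ} (hη : IsTestFunctional η)
    {w : Amp M → ℂ} (hw : ContDiff ℝ 1 w) (p q : Mode M) :
    ∫ α, w α * transferOp p q η α = ∫ α, transferOpDual p q w α * η α := by
  have h1 := hη.contDiff_one
  have hq := contDiff_coord_mul hw q
  have hp := contDiff_conj_coord_mul hw p
  have e : ∀ α, w α * transferOp p q η α =
      (α q * w α) * wirtinger p η α - (conj (α p) * w α) * wirtingerConj q η α := fun α => by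
    rw [transferOp]; ring
  have e' : ∀ α, transferOpDual p q w α * η α =
      -(wirtinger p (fun β => β q * w β) α * η α) +
        wirtingerConj q (fun β => conj (β p) * w β) α * η α := fun α => by
    rw [transferOpDual]; ring
  simp only [e, e']
  rw [integral_sub
    (integrable_mul_of_hasCompactSupport_right hq.continuous (continuous_wirtinger h1 p)
      (hasCompactSupport_wirtinger hη.2 p))
    (integrable_mul_of_hasCompactSupport_right hp.continuous (continuous_wirtingerConj h1 q)
      (hasCompactSupport_wirtingerConj hη.2 q)), integral_add, integral_neg,
    (hη.integral_mul_wirtinger_and_conj hq p).1, (hη.integral_mul_wirtinger_and_conj hp q).2,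
    sub_neg_eq_add]
  · exact (integrable_mul_of_hasCompactSupport_right (continuous_wirtinger hq p)
      h1.continuous hη.2).neg
  · exact integrable_mul_of_hasCompactSupport_right (continuous_wirtingerConj hp q)
      h1.continuous hη.2

namespace RestrictedBasis

variable (b : RestrictedBasis D M)

/-- The weak functional derivatives in the correspondence, at a fixed point `x`, as a combination
of the pairings of `w` with `transferOp`. -/
lemma weakFuncDeriv_add_weakFuncDerivConj (j k : Fin C) (x : EuclideanSpace ℝ (Fin D))
    {w η : Amp M → ℂ} (hw : MemLp w 2) (hη : IsTestFunctional η) :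
    -b.weakFuncDeriv j x (fun α => b.field k α x * w α) η
      + b.weakFuncDerivConj k x (fun α => conj (b.field j α x) * w α) η =
    ∑ p, ∑ q, conj (b.φ j p x) * b.φ k q x * ∫ α, w α * transferOp ⟨j, p⟩ ⟨k, q⟩ η α := by
  have h1 := hη.contDiff_one
  have i1 : ∀ p q : Mode M, Integrable fun α => w α * (α q * wirtinger p η α) := fun p q =>
    integrable_memLp_mul hw ((continuous_apply q).mul (continuous_wirtinger h1 p))
      (hasCompactSupport_wirtinger hη.2 p).mul_left
  have i2 : ∀ p q : Mode M, Integrable fun α => w α * (conj (α p) * wirtingerConj q η α) :=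
    fun p q => integrable_memLp_mul hw
      ((Complex.continuous_conj.comp (continuous_apply p)).mul (continuous_wirtingerConj h1 q))
      (hasCompactSupport_wirtingerConj hη.2 q).mul_left
  have e1 : ∀ α, b.field k α x * w α * b.funcDeriv j x η α = ∑ p, ∑ q,
      conj (b.φ j p x) * b.φ k q x * (w α * (α ⟨k, q⟩ * wirtinger ⟨j, p⟩ η α)) := fun α => by
    rw [field, funcDeriv, mul_assoc, Finset.sum_mul, Finset.sum_comm]
    refine Finset.sum_congr rfl fun q _ => ?_
    rw [Finset.mul_sum, Finset.mul_sum]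
    exact Finset.sum_congr rfl fun p _ => by ring
  have e2 : ∀ α, conj (b.field j α x) * w α * b.funcDerivConj k x η α = ∑ p, ∑ q,
      conj (b.φ j p x) * b.φ k q x * (w α * (conj (α ⟨j, p⟩) * wirtingerConj ⟨k, q⟩ η α)) :=
      fun α => by
    rw [field, funcDerivConj, map_sum, mul_assoc, Finset.sum_mul]
    refine Finset.sum_congr rfl fun p _ => ?_
    rw [Finset.mul_sum, Finset.mul_sum]
    exact Finset.sum_congr rfl fun q _ => by rw [map_mul]; ring
  have e3 : ∀ p q : Mode M, ∫ α, w α * transferOp p q η α =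
      (∫ α, w α * (α q * wirtinger p η α)) - ∫ α, w α * (conj (α p) * wirtingerConj q η α) := by
    intro p q
    rw [← integral_sub (i1 p q) (i2 p q)]
    refine integral_congr_ae (ae_of_all _ fun α => ?_)
    simp only [transferOp]
    ring
  simp only [weakFuncDeriv, weakFuncDerivConj, e1, e2, neg_neg]
  rw [integral_finsetSum _ fun p _ => integrable_finsetSum _ fun q _ => (i1 _ _).const_mul _,
    integral_finsetSum _ fun p _ => integrable_finsetSum _ fun q _ => (i2 _ _).const_mul _,
    ← sub_eq_add_neg, ← Finset.sum_sub_distrib]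
  refine Finset.sum_congr rfl fun p _ => ?_
  rw [integral_finsetSum _ fun q _ => (i1 _ _).const_mul _,
    integral_finsetSum _ fun q _ => (i2 _ _).const_mul _, ← Finset.sum_sub_distrib]
  refine Finset.sum_congr rfl fun q _ => ?_
  rw [integral_const_mul, integral_const_mul, e3, mul_sub]

/-- The classical functional derivatives in the correspondence, integrated over `x`. -/
lemma integral_funcDeriv_add_funcDerivConj (j k : Fin C) {w : Amp M → ℂ} (hw : ContDiff ℝ 1 w)
    (α : Amp M) :
    ∫ x in b.region, (-b.funcDeriv j x (fun β => b.field k β x * w β) α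
      + b.funcDerivConj k x (fun β => conj (b.field j β x) * w β) α) =
    ∑ p, ∑ q, b.overlap j k p q * transferOpDual ⟨j, p⟩ ⟨k, q⟩ w α := by
  rw [← b.integral_sum_sum]
  refine integral_congr_ae (ae_of_all _ fun x => ?_)
  have e1 : (fun β => b.field k β x * w β) = fun β => ∑ q, b.φ k q x * (β ⟨k, q⟩ * w β) := by
    funext β
    rw [field, Finset.sum_mul]
    exact Finset.sum_congr rfl fun q _ => by ring
  have e2 : (fun β => conj (b.field j β x) * w β) =
      fun β => ∑ p, conj (b.φ j p x) * (conj (β ⟨j, p⟩) * w β) := by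
    funext β
    rw [field, map_sum, Finset.sum_mul]
    exact Finset.sum_congr rfl fun q _ => by rw [map_mul]; ring
  simp only [funcDeriv, funcDerivConj]
  rw [e1, e2]
  simp only [wirtinger_sum_const_mul _ _ fun q =>
      (contDiff_coord_mul hw ⟨k, q⟩).differentiable one_ne_zero,
    wirtingerConj_sum_const_mul _ _ fun p =>
      (contDiff_conj_coord_mul hw ⟨j, p⟩).differentiable one_ne_zero, Finset.mul_sum,
    transferOpDual]
  rw [Finset.sum_comm (s := (Finset.univ : Finset (M k))), ← Finset.sum_neg_distrib,
    ← Finset.sum_add_distrib]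
  refine Finset.sum_congr rfl fun p _ => ?_
  rw [← Finset.sum_neg_distrib, ← Finset.sum_add_distrib]
  exact Finset.sum_congr rfl fun q _ => by ring

lemma integral_wigner_commutator {j k : Fin C} {A B : Fock M →L[ℂ] Fock M}
    (hA : IsHilbertSchmidt A) (hB : IsHilbertSchmidt B)
    (hAB : IsCommutator (b.bilinearOp j k) A B) {η : Amp M → ℂ} (hη : IsTestFunctional η) :
    ∫ α, b.wigner B α * η α = ∑ p, ∑ q, b.overlap j k p q *
      ∫ α, b.wigner A α * transferOp ⟨j, p⟩ ⟨k, q⟩ η α := by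
  have eA := (b.isWignerTransform_wigner hA).ae_eq hA
  have eB := (b.isWignerTransform_wigner hB).ae_eq hB
  have key : ∀ {v w ζ : Amp M → ℂ}, v =ᵐ[volume] w → ∫ α, v α * ζ α = ∫ α, w α * ζ α :=
    fun h => integral_congr_ae (h.mono fun α hα => by simp only [hα])
  rw [key eB, b.integral_wignerMap_commutator hA hB hAB hη]
  simp only [key eA]

end RestrictedBasis

end Modes

end FunctionalWigner

theorem mainTheorem5 {D C : ℕ} {M : Fin C → Type*}
    [∀ j, Fintype (M j)] [∀ j, DecidableEq (M j)]
    (b : FunctionalWigner.RestrictedBasis D M) (j k : Fin C)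
    (A B : FunctionalWigner.Fock M →L[ℂ] FunctionalWigner.Fock M)
    (hA : FunctionalWigner.IsHilbertSchmidt A) (hB : FunctionalWigner.IsHilbertSchmidt B)
    (hAB : FunctionalWigner.IsCommutator (b.bilinearOp j k) A B) :
    b.IsWignerTransform A (b.wigner A) ∧ b.IsWignerTransform B (b.wigner B) ∧
    (∀ η : FunctionalWigner.Amp M → ℂ, FunctionalWigner.IsTestFunctional η →
      ∫ α, b.wigner B α * η α =
        ∫ x in b.region,
          (-b.weakFuncDeriv j x (fun α => b.field k α x * b.wigner A α) η
            + b.weakFuncDerivConj k x (fun α => conj (b.field j α x) * b.wigner A α) η)) ∧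
    (∀ w : FunctionalWigner.Amp M → ℂ, ContDiff ℝ 1 w → w =ᵐ[volume] b.wigner A →
      ∀ᵐ α, b.wigner B α =
        ∫ x in b.region,
          (-b.funcDeriv j x (fun β => b.field k β x * w β) α
            + b.funcDerivConj k x (fun β => conj (b.field j β x) * w β) α)) := by
  have wA := b.isWignerTransform_wigner hA
  have wB := b.isWignerTransform_wigner hB
  refine ⟨wA, wB, fun η hη => ?_, fun w hw hwA => ?_⟩
  · rw [b.integral_wigner_commutator hA hB hAB hη]
    simp only [b.weakFuncDeriv_add_weakFuncDerivConj j k _ wA.1 hη]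
    exact (b.integral_sum_sum j k _).symm
  · simp only [b.integral_funcDeriv_add_funcDerivConj j k hw]
    have hcont : Continuous fun α => ∑ p, ∑ q, b.overlap j k p q *
        FunctionalWigner.transferOpDual ⟨j, p⟩ ⟨k, q⟩ w α :=
      continuous_finsetSum _ fun p _ => continuous_finsetSum _ fun q _ =>
        continuous_const.mul (FunctionalWigner.continuous_transferOpDual hw _ _)
    -- both sides have the same pairings with test functionals
    refine ae_eq_of_integral_contDiff_smul_eq (wB.1.locallyIntegrable (by norm_num))
      hcont.locallyIntegrable fun g hg hgs => ?_
    have hη : FunctionalWigner.IsTestFunctional (M := M) fun α => (g α : ℂ) :=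
      ⟨Complex.ofRealCLM.contDiff.comp hg, hgs.comp_left Complex.ofReal_zero⟩
    have h := b.integral_wigner_commutator hA hB hAB hη
    have hi : ∀ p q : FunctionalWigner.Mode M,
        Integrable fun α => FunctionalWigner.transferOpDual p q w α * (g α : ℂ) := fun p q =>
      FunctionalWigner.integrable_mul_of_hasCompactSupport_right
        (FunctionalWigner.continuous_transferOpDual hw p q) hη.1.continuous hη.2
    have hwA' : ∀ ζ : FunctionalWigner.Amp M → ℂ,
        ∫ α, b.wigner A α * ζ α = ∫ α, w α * ζ α := fun ζ =>
      integral_congr_ae (hwA.mono fun α hα => by simp only [hα])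
    simp only [hwA', hη.integral_mul_transferOp hw, ← integral_const_mul] at h
    simp only [Complex.real_smul, mul_comm (Complex.ofReal _), Finset.sum_mul, mul_assoc]
    rw [h, integral_finsetSum _ fun p _ => integrable_finsetSum _ fun q _ =>
      (hi _ _).const_mul _]
    exact Finset.sum_congr rfl fun p _ =>
      (integral_finsetSum _ fun q _ => (hi _ _).const_mul _).symm
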